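/- Let $n\in\mathbb N$, let $\sigma=(\sigma_{ij})$ be a non-zero real symmetric $n\times n$ matrix (so $n\ge 1$), and let $a,b>0$ be real numbers. On $\widetilde N=\mathbb R^{4n}\setminus\{0\}$ with coordinates $x^1,\dots,x^{4n}$ consider the semi-Riemannian metric $$g \;=\; 2\sum_{k=1}^{2n} \mathrm dx^k\,\mathrm dx^{k+2n}\;+\;\Bigl(\sum_{i,j=1}^n\sigma_{ij}\,\mathrm d\bigl(x^i x^{j+n}\bigr)\Bigr)^2 ,$$ and let $\Gamma_{a,b}$ be the cyclic group generated by the linear homothety of $(\widetilde N,g)$ $$\phi_{a,b}=\operatorname{diag}\bigl(e^{a}\mathbf 1_n,\;e^{b}\mathbf 1_n,\;e^{a+2b}\mathbf 1_n,\;e^{2a+b}\mathbf 1_n\bigr).$$ Then the quotient $N_{a,b}=\widetilde N/\Gamma_{a,b}$, with the quotient topology, is compact, Hausdorff and second countable, and has a smooth structure for which the projection $\pi:\widetilde N\to N_{a,b}$ is a local diffeomorphism. With this structure $N_{a,b}$ is diffeomorphic to $S^1\times S^{4n-1}$. Moreover there is a smooth semi-Riemannian metric $c$ of signature $(2n,2n)$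 on $N_{a,b}$ with $\pi^*c=e^{2u}g$ for some $u\in C^\infty(\widetilde N)$ (so $g$ induces the conformal structure $[c]=\{e^{2f}c : f\in C^\infty(N_{a,b})\}$ on $N_{a,b}$), such that: 1. $c$ is locally conformal to a Ricci-flat metric: every point of $N_{a,b}$ has an open neighbourhood $U$ and a function $f\in C^\infty(U)$ such that $e^{2f}c$ is Ricci-flat on $U$; 2. $c$ is not conformally flat: it is not true that every point of $N_{a,b}$ has an open neighbourhood $U$ and a function $f\in C^\infty(U)$ such that $e^{2f}c$ is flat on $U$; 3. $(N_{a,b},[c])$ has an essential conformal transformation: there is a diffeomorphism $\psi$ of $N_{a,b}$ with $\psi^*c=e^{2f}c$ for some $f\in C^\infty(N_{a,b})$, such that no metric in $[c]$ is preserved by $\psi$. -/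

import Mathlib

open scoped Manifold ContDiff Topology

noncomputable section

namespace ConformalQuotient

/-! ### Semi-Riemannian and conformal geometry on manifolds modelled on `ℝ^ι` -/

section General

variable {ι : Type} [Fintype ι] [DecidableEq ι]
variable {M : Type} [TopologicalSpace M] [ChartedSpace (EuclideanSpace ℝ ι) M]
variable {M' : Type} [TopologicalSpace M'] [ChartedSpace (EuclideanSpace ℝ ι) M']

variable (ι M) in
/-- A (not necessarily smooth) covariant 2-tensor field on `M`. -/
abbrev TwoTensor : Type :=
  ∀ x : M, TangentSpace 𝓘(ℝ, EuclideanSpace ℝ ι) x →L[ℝ]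
    TangentSpace 𝓘(ℝ, EuclideanSpace ℝ ι) x →L[ℝ] ℝ

/-- `g` is a smooth semi-Riemannian metric of signature `(p, q)`: a smooth field of symmetric
bilinear forms, each of which has an orthonormal basis with `p` negative and `q` positive
vectors (so that it is nondegenerate). -/
structure IsSemiRiemannianMetric [IsManifold 𝓘(ℝ, EuclideanSpace ℝ ι) ∞ M]
    (p q : ℕ) (g : TwoTensor ι M) : Prop where
  smooth : ContMDiff 𝓘(ℝ, EuclideanSpace ℝ ι)
    (𝓘(ℝ, EuclideanSpace ℝ ι).prod
      𝓘(ℝ, EuclideanSpace ℝ ι →L[ℝ] EuclideanSpace ℝ ι →L[ℝ] ℝ)) ∞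
    (fun x : M => Bundle.TotalSpace.mk' (EuclideanSpace ℝ ι →L[ℝ] EuclideanSpace ℝ ι →L[ℝ] ℝ)
      (E := fun x : M => TangentSpace 𝓘(ℝ, EuclideanSpace ℝ ι) x →L[ℝ]
        TangentSpace 𝓘(ℝ, EuclideanSpace ℝ ι) x →L[ℝ] ℝ) x (g x))
  symm : ∀ (x : M) (v w : TangentSpace 𝓘(ℝ, EuclideanSpace ℝ ι) x), g x v w = g x w v
  signature : ∀ x : M, ∃ b : Module.Basis (Fin p ⊕ Fin q) ℝ
      (TangentSpace 𝓘(ℝ, EuclideanSpace ℝ ι) x),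
    (∀ i j, i ≠ j → g x (b i) (b j) = 0) ∧
    (∀ i, g x (b (Sum.inl i)) (b (Sum.inl i)) = -1) ∧
    (∀ j, g x (b (Sum.inr j)) (b (Sum.inr j)) = 1)

/-- The conformally rescaled tensor `e^{2u} g`. -/
def rescale (u : M → ℝ) (g : TwoTensor ι M) : TwoTensor ι M :=
  fun x => Real.exp (2 * u x) • g x

/-- `h` belongs to the conformal class of `g`: `h = e^{2u} g` with `u` smooth on all of `M`. -/
def InConformalClass (g h : TwoTensor ι M) : Prop :=
  ∃ u : M → ℝ, ContMDiff 𝓘(ℝ, EuclideanSpace ℝ ι) 𝓘(ℝ, ℝ) ∞ u ∧ h = rescale u g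

/-- The pullback `F^* h`, that is `(F^* h)_x (v, w) = h_{F x} (dF_x v, dF_x w)`. (Every tangent space
is, by definition, a copy of the model space `ℝ^ι`.) -/
def pullback (F : M → M') (h : TwoTensor ι M') : TwoTensor ι M :=
  fun x =>
    let B : EuclideanSpace ℝ ι →L[ℝ] EuclideanSpace ℝ ι →L[ℝ] ℝ := h (F x)
    let A : EuclideanSpace ℝ ι →L[ℝ] EuclideanSpace ℝ ι :=
      mfderiv 𝓘(ℝ, EuclideanSpace ℝ ι) 𝓘(ℝ, EuclideanSpace ℝ ι) F x
    B.bilinearComp A A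

/-- The diffeomorphism `ψ` is a conformal transformation of `(M, g)`: `ψ^* g = e^{2u} g`
for a smooth function `u`. -/
def IsConformalTransformation (g : TwoTensor ι M)
    (ψ : M ≃ₘ^∞⟮𝓘(ℝ, EuclideanSpace ℝ ι), 𝓘(ℝ, EuclideanSpace ℝ ι)⟯ M) : Prop :=
  InConformalClass g (pullback ψ g)

/-- `ψ` is an essential conformal transformation of `(M, g)`: it is a conformal transformation,
and there is no metric in the conformal class of `g` of which `ψ` (equivalently, every element of
the group generated by `ψ`) is an isometry. -/
def IsEssential (g : TwoTensor ι M)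
    (ψ : M ≃ₘ^∞⟮𝓘(ℝ, EuclideanSpace ℝ ι), 𝓘(ℝ, EuclideanSpace ℝ ι)⟯ M) : Prop :=
  IsConformalTransformation g ψ ∧ ¬ ∃ h : TwoTensor ι M, InConformalClass g h ∧ pullback ψ h = h

/-! #### Curvature in coordinates -/

/-- The partial derivative `∂_i f (y)`. -/
def partialDeriv (i : ι) (f : EuclideanSpace ℝ ι → ℝ) (y : EuclideanSpace ℝ ι) : ℝ :=
  fderiv ℝ f y (EuclideanSpace.single i 1)

/-- The Christoffel symbol
`Γ^k_{ij} = ½ ∑_l G^{kl} (∂_i G_{jl} + ∂_j G_{il} - ∂_l G_{ij})` of a field `G` of matrices. -/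
def christoffel (G : EuclideanSpace ℝ ι → Matrix ι ι ℝ) (k i j : ι)
    (y : EuclideanSpace ℝ ι) : ℝ :=
  (1 / 2) * ∑ l, (G y)⁻¹ k l *
    (partialDeriv i (fun z => G z j l) y + partialDeriv j (fun z => G z i l) y
      - partialDeriv l (fun z => G z i j) y)

/-- The component `R^l_{kij}` of the curvature tensor, `R(∂_i, ∂_j) ∂_k = ∑_l R^l_{kij} ∂_l`. -/
def curvatureComponent (G : EuclideanSpace ℝ ι → Matrix ι ι ℝ) (l k i j : ι)
    (y : EuclideanSpace ℝ ι) : ℝ :=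
  partialDeriv i (christoffel G l j k) y - partialDeriv j (christoffel G l i k) y
    + ∑ m, (christoffel G l i m y * christoffel G m j k y
      - christoffel G l j m y * christoffel G m i k y)

/-- The component `Ric_{jk} = ∑_i R^i_{kij}` of the Ricci tensor. -/
def ricciComponent (G : EuclideanSpace ℝ ι → Matrix ι ι ℝ) (j k : ι)
    (y : EuclideanSpace ℝ ι) : ℝ :=
  ∑ i, curvatureComponent G i k i j y

/-- The matrix `g(∂_i, ∂_j)` of `g` in the coordinates given by the chart `e`, as a function on
the target of `e`. -/
def coordMatrix (g : TwoTensor ι M) (e : OpenPartialHomeomorph M (EuclideanSpace ℝ ι))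
    (y : EuclideanSpace ℝ ι) : Matrix ι ι ℝ :=
  Matrix.of fun i j =>
    g (e.symm y)
      (mfderiv 𝓘(ℝ, EuclideanSpace ℝ ι) 𝓘(ℝ, EuclideanSpace ℝ ι) e.symm y
        (EuclideanSpace.single i (1 : ℝ) : EuclideanSpace ℝ ι))
      (mfderiv 𝓘(ℝ, EuclideanSpace ℝ ι) 𝓘(ℝ, EuclideanSpace ℝ ι) e.symm y
        (EuclideanSpace.single j (1 : ℝ) : EuclideanSpace ℝ ι))

/-- The curvature tensor of `g` vanishes at every point of `U`: in every chart of the atlas, its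
components are zero on `U`. -/
def IsFlatOn (g : TwoTensor ι M) (U : Set M) : Prop :=
  ∀ e ∈ atlas (EuclideanSpace ℝ ι) M, ∀ x ∈ e.source ∩ U, ∀ l k i j : ι,
    curvatureComponent (coordMatrix g e) l k i j (e x) = 0

/-- The Ricci tensor of `g` vanishes at every point of `U`: in every chart of the atlas, its
components are zero on `U`. -/
def IsRicciFlatOn (g : TwoTensor ι M) (U : Set M) : Prop :=
  ∀ e ∈ atlas (EuclideanSpace ℝ ι) M, ∀ x ∈ e.source ∩ U, ∀ j k : ι,
    ricciComponent (coordMatrix g e) j k (e x) = 0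

/-- Every point has an open neighbourhood `U` with a smooth function `u` on `U` such that
`e^{2u} g` is Ricci-flat on `U`. -/
def IsLocallyConformallyRicciFlat (g : TwoTensor ι M) : Prop :=
  ∀ p : M, ∃ U : Set M, IsOpen U ∧ p ∈ U ∧ ∃ u : M → ℝ,
    ContMDiffOn 𝓘(ℝ, EuclideanSpace ℝ ι) 𝓘(ℝ, ℝ) ∞ u U ∧ IsRicciFlatOn (rescale u g) U

/-- Every point has an open neighbourhood `U` with a smooth function `u` on `U` such that
`e^{2u} g` is flat on `U`. -/
def IsConformallyFlat (g : TwoTensor ι M) : Prop :=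
  ∀ p : M, ∃ U : Set M, IsOpen U ∧ p ∈ U ∧ ∃ u : M → ℝ,
    ContMDiffOn 𝓘(ℝ, EuclideanSpace ℝ ι) 𝓘(ℝ, ℝ) ∞ u U ∧ IsFlatOn (rescale u g) U

end General

/-! ### The metric on `ℝ^{4n} ∖ {0}` and the quotient -/

section Construction

variable {n : ℕ}

/-- `ℝ^{4n}`, with its coordinates arranged in four blocks of length `n`: the coordinate
`x^{i + kn}` (`k = 0, 1, 2, 3`) is `x (k, i)`. -/
abbrev Space (n : ℕ) : Type := EuclideanSpace ℝ (Fin 4 × Fin n)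

/-- `ℝ^{4n} ∖ {0}`. -/
def punctured (n : ℕ) : TopologicalSpace.Opens (Space n) := ⟨{0}ᶜ, isOpen_compl_singleton⟩

/-- The quadratic polynomial `σ_{ij} x^i x^{j+n}`. -/
def quadPoly (σ : Matrix (Fin n) (Fin n) ℝ) (x : Space n) : ℝ :=
  ∑ i, ∑ j, σ i j * (x (0, i) * x (1, j))

/-- The tensor product `α ⊗ β` of two covectors. -/
def covTensor (α β : Space n →L[ℝ] ℝ) : Space n →L[ℝ] Space n →L[ℝ] ℝ := α.smulRight β

/-- The coordinate differential of the `i`-th coordinate of block `k`. -/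
def dx (k : Fin 4) (i : Fin n) : Space n →L[ℝ] ℝ := EuclideanSpace.proj (k, i)

/-- The symmetric bilinear form at `x` given by
`2 δ_{ab} dx^a dx^{b+2n} + (σ_{ij} d(x^i x^{j+n}))²`, where `2 α β = α ⊗ β + β ⊗ α` and the index
`a ∈ {1, …, 2n}` runs through the blocks `0` and `1`. -/
def metricForm (σ : Matrix (Fin n) (Fin n) ℝ) (x : Space n) :
    Space n →L[ℝ] Space n →L[ℝ] ℝ :=
  ∑ i, (covTensor (dx 0 i) (dx 2 i) + covTensor (dx 2 i) (dx 0 i))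
    + ∑ i, (covTensor (dx 1 i) (dx 3 i) + covTensor (dx 3 i) (dx 1 i))
    + covTensor (fderiv ℝ (quadPoly σ) x) (fderiv ℝ (quadPoly σ) x)

/-- The metric `g` on `ℝ^{4n} ∖ {0}`. -/
def metric (σ : Matrix (Fin n) (Fin n) ℝ) : TwoTensor (Fin 4 × Fin n) (punctured n) :=
  fun x => metricForm σ (x : Space n)

/-- The exponents of the four blocks of `φ_{a,b}`. -/
def weight (a b : ℝ) : Fin 4 → ℝ := ![a, b, a + 2 * b, 2 * a + b]

/-- The linear map `φ_{a,b} = diag(e^a 1_n, e^b 1_n, e^{a+2b} 1_n, e^{2a+b} 1_n)`. -/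
def scaling (n : ℕ) (a b : ℝ) : Space n ≃ₗ[ℝ] Space n where
  toFun x := WithLp.toLp 2 fun p => Real.exp (weight a b p.1) * x p
  invFun x := WithLp.toLp 2 fun p => Real.exp (-weight a b p.1) * x p
  map_add' x y := by ext p; simp [mul_add]
  map_smul' c x := by ext p; simp [mul_left_comm]
  left_inv x := by ext p; simp [← mul_assoc, ← Real.exp_add]
  right_inv x := by ext p; simp [← mul_assoc, ← Real.exp_add]

/-- `φ_{a,b}` as a permutation of `ℝ^{4n} ∖ {0}`. -/
def scalingPerm (n : ℕ) (a b : ℝ) : Equiv.Perm (punctured n) :=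
  (scaling n a b).toEquiv.subtypeEquiv fun x =>
    (not_congr (LinearEquiv.map_eq_zero_iff (scaling n a b) (x := x))).symm

/-- The quotient of `ℝ^{4n} ∖ {0}` by the cyclic group generated by `φ_{a,b}`, with the quotient
topology. -/
abbrev QuotientSpace (n : ℕ) (a b : ℝ) : Type :=
  MulAction.orbitRel.Quotient (Subgroup.zpowers (scalingPerm n a b)) (punctured n)

/-- The projection onto the quotient. -/
def proj (n : ℕ) (a b : ℝ) (x : punctured n) : QuotientSpace n a b := Quotient.mk _ x

end Construction

end ConformalQuotient

end

noncomputable section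

namespace ConformalQuotient

/-! ### Conformal change of the Christoffel symbols -/

section ConformalChange

/-! Write q for the quadratic polynomial and J for the constant pairing of blocks 0, 1 with blocks
2, 3, so that g = J + dq ⊗ dq. Since q involves only blocks 0 and 1, while `dual` exchanges these
with blocks 2 and 3, the J-raised gradient of q is null and is annihilated by the Hessian. Hence the
inverse metric is an explicit rank-one correction of J, Γ^k_{ij} = q^k q_{ij}, the products ΓΓ
vanish, and the curvature is a constant quadratic expression in the Hessian
(`curvatureComponent_gram`) whose trace is zero (`ricciComponent_gram`).

The maps φ_{ta,tb} form an expanding linear flow scaling g by e^{2t(a+b)} (`metricForm_scaling`).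
Every nonzero orbit crosses the unit sphere exactly once, and the crossing time gives a smooth
function with τ(φ_t x) = τ(x) + t (`time_flow`, `contDiffAt_time`). With u = -(a+b)τ the form
e^{2u}g is invariant and descends to a metric c. Slabs of width 1 in τ inject into the quotient and
provide the charts, with powers of φ_{a,b} as local transition maps. The pair (e^{2πiτ}, point of
the sphere reached along the flow) gives the diffeomorphism with S¹ × S^{4n-1} (`diffeoProd`), from
which compactness and the separation and countability properties follow.

Locally, undoing u recovers the Ricci-flat g. For conformal flatness, take a point where dq = 0: the
curvature component of e^{2h}g with upper index (2,p) and lower indices (1,q), (1,q), (0,p) is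
σ_{pq}² whatever h is (`curvatureComponent_exp_smul_gram`), because all correction terms carry a
Kronecker delta or a metric coefficient that vanishes there. Some σ_{pq} is nonzero, so c is not
conformally flat.

Finally φ_{0,1} commutes with φ_{a,b} and so descends. It fixes a nonzero point while multiplying g
by e², so no conformal rescaling of c can be invariant (`isEssential_scalingDiffeo`). -/

theorem partialDeriv_congr {ι : Type} [DecidableEq ι] {i : ι} {f g : EuclideanSpace ℝ ι → ℝ} {y : EuclideanSpace ℝ ι}
    (h : f =ᶠ[𝓝 y] g) : partialDeriv i f y = partialDeriv i g y := by
  simp only [partialDeriv, h.fderiv_eq]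

variable {ι : Type} [Fintype ι] [DecidableEq ι]

theorem christoffel_congr {G G' : EuclideanSpace ℝ ι → Matrix ι ι ℝ} {y : EuclideanSpace ℝ ι}
    (h : G =ᶠ[𝓝 y] G') (k i j : ι) : christoffel G k i j y = christoffel G' k i j y := by
  have hc (p q : ι) : (fun z => G z p q) =ᶠ[𝓝 y] fun z => G' z p q :=
    h.mono fun z hz => by simp only [hz]
  simp only [christoffel, h.eq_of_nhds, partialDeriv_congr (hc _ _)]

theorem curvatureComponent_congr {G G' : EuclideanSpace ℝ ι → Matrix ι ι ℝ}
    {y : EuclideanSpace ℝ ι} (h : G =ᶠ[𝓝 y] G') (l k i j : ι) :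
    curvatureComponent G l k i j y = curvatureComponent G' l k i j y := by
  have hc (p q r : ι) : christoffel G p q r =ᶠ[𝓝 y] christoffel G' p q r :=
    h.eventuallyEq_nhds.mono fun z hz => christoffel_congr hz p q r
  simp only [curvatureComponent, (hc _ _ _).eq_of_nhds, partialDeriv_congr (hc _ _ _)]

theorem ricciComponent_congr {G G' : EuclideanSpace ℝ ι → Matrix ι ι ℝ}
    {y : EuclideanSpace ℝ ι} (h : G =ᶠ[𝓝 y] G') (j k : ι) :
    ricciComponent G j k y = ricciComponent G' j k y := by
  simp only [ricciComponent, curvatureComponent_congr h]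

/-- The Christoffel symbols of the conformally rescaled metric `e^{2h} G`. -/
theorem christoffel_conformal {G : EuclideanSpace ℝ ι → Matrix ι ι ℝ}
    {h : EuclideanSpace ℝ ι → ℝ} {y : EuclideanSpace ℝ ι}
    (hG : ∀ i j, DifferentiableAt ℝ (fun z => G z i j) y) (hsymm : (G y).IsSymm)
    (hdet : IsUnit (G y).det) (hh : DifferentiableAt ℝ h y) (k i j : ι) :
    christoffel (fun z => Real.exp (2 * h z) • G z) k i j y =
      christoffel G k i j y + (if k = j then partialDeriv i h y else 0)
        + (if k = i then partialDeriv j h y else 0)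
        - G y i j * ∑ l, (G y)⁻¹ k l * partialDeriv l h y := by
  have hd (p q r : ι) : partialDeriv p (fun z => (Real.exp (2 * h z) • G z) q r) y =
      Real.exp (2 * h y) * (2 * partialDeriv p h y * G y q r
        + partialDeriv p (fun z => G z q r) y) := by
    have h1 : HasFDerivAt (fun z => Real.exp (2 * h z) * G z q r) _ y :=
      ((hh.hasFDerivAt.const_mul 2).exp).mul (hG q r).hasFDerivAt
    simp only [partialDeriv, Matrix.smul_apply, smul_eq_mul, h1.fderiv]
    simp
    ring
  have hinv : (Real.exp (2 * h y) • G y)⁻¹ = Real.exp (-(2 * h y)) • (G y)⁻¹ := by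
    apply Matrix.inv_eq_right_inv
    rw [Matrix.smul_mul, Matrix.mul_smul, Matrix.mul_nonsing_inv _ hdet, smul_smul,
      ← Real.exp_add, add_neg_cancel, Real.exp_zero, one_smul]
  have hδ (m : ι) : ∑ l, (G y)⁻¹ k l * G y m l = if k = m then 1 else 0 := by
    have := congrFun (congrFun (Matrix.nonsing_inv_mul _ hdet) k) m
    rw [Matrix.mul_apply, Matrix.one_apply] at this
    rw [← this]
    exact Finset.sum_congr rfl fun l _ => by rw [hsymm.apply]
  have hexp : Real.exp (-(2 * h y)) * Real.exp (2 * h y) = 1 := by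
    rw [← Real.exp_add, neg_add_cancel, Real.exp_zero]
  have hterm (l : ι) : (Real.exp (2 * h y) • G y)⁻¹ k l *
      (partialDeriv i (fun z => (Real.exp (2 * h z) • G z) j l) y
        + partialDeriv j (fun z => (Real.exp (2 * h z) • G z) i l) y
        - partialDeriv l (fun z => (Real.exp (2 * h z) • G z) i j) y) =
      (G y)⁻¹ k l * (partialDeriv i (fun z => G z j l) y
        + partialDeriv j (fun z => G z i l) y - partialDeriv l (fun z => G z i j) y)
      + 2 * partialDeriv i h y * ((G y)⁻¹ k l * G y j l)
      + 2 * partialDeriv j h y * ((G y)⁻¹ k l * G y i l)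
      - 2 * G y i j * ((G y)⁻¹ k l * partialDeriv l h y) := by
    rw [hinv, hd, hd, hd, Matrix.smul_apply, smul_eq_mul]
    linear_combination ((G y)⁻¹ k l * (2 * partialDeriv i h y * G y j l
        + partialDeriv i (fun z => G z j l) y + (2 * partialDeriv j h y * G y i l
        + partialDeriv j (fun z => G z i l) y) - (2 * partialDeriv l h y * G y i j
        + partialDeriv l (fun z => G z i j) y))) * hexp
  simp only [christoffel]
  rw [Finset.sum_congr rfl fun l _ => hterm l]
  simp only [Finset.sum_add_distrib, Finset.sum_sub_distrib, ← Finset.mul_sum, hδ]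
  split_ifs <;> ring

end ConformalChange

/-! ### The metric in coordinates -/

section Coordinates

variable {n : ℕ}

/-- The index dual to `p` under the pairing `2 δ_{ab} dx^a dx^{b+2n}`. -/
def dual (p : Fin 4 × Fin n) : Fin 4 × Fin n := (p.1 + 2, p.2)

theorem dual_dual (p : Fin 4 × Fin n) : dual (dual p) = p := by
  obtain ⟨k, i⟩ := p
  simp only [dual, Prod.mk.injEq, and_true]
  fin_cases k <;> rfl

theorem eq_dual_comm {p q : Fin 4 × Fin n} : q = dual p ↔ p = dual q :=
  ⟨fun h => by rw [h, dual_dual], fun h => by rw [h, dual_dual]⟩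

/-- The (constant) Hessian of the quadratic polynomial `quadPoly σ`. -/
def hess (σ : Matrix (Fin n) (Fin n) ℝ) (p q : Fin 4 × Fin n) : ℝ :=
  if p.1 = 0 ∧ q.1 = 1 then σ p.2 q.2 else if p.1 = 1 ∧ q.1 = 0 then σ q.2 p.2 else 0

/-- The partial derivatives of `quadPoly σ`. -/
def grad (σ : Matrix (Fin n) (Fin n) ℝ) (p : Fin 4 × Fin n) : Space n →L[ℝ] ℝ :=
  ∑ q, hess σ p q • EuclideanSpace.proj q

variable (σ : Matrix (Fin n) (Fin n) ℝ)

theorem hess_comm (p q : Fin 4 × Fin n) : hess σ p q = hess σ q p := by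
  obtain ⟨k, i⟩ := p
  obtain ⟨l, j⟩ := q
  fin_cases k <;> fin_cases l <;> simp [hess]

theorem hess_eq_zero {p : Fin 4 × Fin n} (hp : 2 ≤ p.1) (q : Fin 4 × Fin n) : hess σ p q = 0 := by
  obtain ⟨k, i⟩ := p
  fin_cases k <;> simp_all [hess]

/-- The source of all cancellations below: gradient and Hessian vanish on the last two blocks, so
any product of one entry at p and one at `dual p` is zero. -/
theorem two_le_or_two_le_dual (p : Fin 4 × Fin n) : 2 ≤ p.1 ∨ 2 ≤ (dual p).1 := by
  obtain ⟨k, i⟩ := p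
  fin_cases k <;> simp [dual]

theorem grad_apply (p : Fin 4 × Fin n) (y : Space n) : grad σ p y = ∑ q, hess σ p q * y q := by
  simp [grad]

theorem grad_single (p q : Fin 4 × Fin n) :
    grad σ p (EuclideanSpace.single q (1 : ℝ)) = hess σ p q := by
  simp [grad_apply]

theorem grad_eq_zero {p : Fin 4 × Fin n} (hp : 2 ≤ p.1) : grad σ p = 0 := by
  ext y
  simp [grad_apply, hess_eq_zero σ hp]

theorem hess_mul_hess_dual (p q r : Fin 4 × Fin n) : hess σ p q * hess σ (dual p) r = 0 := by
  rcases two_le_or_two_le_dual p with h | h <;> simp [hess_eq_zero σ h]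

theorem hess_mul_grad_dual (p q : Fin 4 × Fin n) (y : Space n) :
    hess σ p q * grad σ (dual p) y = 0 := by
  rcases two_le_or_two_le_dual p with h | h
  · simp [hess_eq_zero σ h]
  · simp [grad_eq_zero σ h]

theorem grad_mul_grad_dual (p : Fin 4 × Fin n) (y : Space n) :
    grad σ p y * grad σ (dual p) y = 0 := by
  rcases two_le_or_two_le_dual p with h | h <;> simp [grad_eq_zero σ h]

theorem hess_dual_self (p : Fin 4 × Fin n) : hess σ (dual p) p = 0 := by
  rcases two_le_or_two_le_dual p with h | h
  · rw [hess_comm, hess_eq_zero σ h]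
  · rw [hess_eq_zero σ h]

theorem sum_fin_four_prod (f : Fin 4 × Fin n → ℝ) :
    ∑ q, f q = ∑ i, f (0, i) + ∑ i, f (1, i) + ∑ i, f (2, i) + ∑ i, f (3, i) := by
  rw [Fintype.sum_prod_type, Fin.sum_univ_four]

theorem hasFDerivAt_quadPoly (y : Space n) :
    HasFDerivAt (quadPoly σ) (∑ p, grad σ p y • (EuclideanSpace.proj p : Space n →L[ℝ] ℝ)) y := by
  have hp (p : Fin 4 × Fin n) : HasFDerivAt (fun x : Space n => x p)
      (EuclideanSpace.proj p : Space n →L[ℝ] ℝ) y :=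
    (EuclideanSpace.proj p : Space n →L[ℝ] ℝ).hasFDerivAt
  have h : HasFDerivAt (quadPoly σ) _ y :=
    HasFDerivAt.fun_sum fun i _ => HasFDerivAt.fun_sum fun j _ =>
      ((hp (0, i)).mul (hp (1, j))).const_mul (σ i j)
  refine h.congr_fderiv ?_
  ext v
  have h2 (i : Fin n) : grad σ (2, i) = 0 := grad_eq_zero σ (le_refl (2 : Fin 4))
  have h3 (i : Fin n) : grad σ (3, i) = 0 := grad_eq_zero σ (by decide : (2 : Fin 4) ≤ 3)
  simp only [sum_apply, smul_apply,
    add_apply, PiLp.proj_apply, smul_eq_mul]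
  rw [sum_fin_four_prod]
  simp only [h2, h3, zero_apply, zero_mul, Finset.sum_const_zero, add_zero,
    grad_apply, sum_fin_four_prod]
  simp only [hess]
  simp [mul_add, Finset.sum_add_distrib, Finset.sum_mul]
  rw [add_comm]
  congr 1
  · refine Finset.sum_congr rfl fun i _ => Finset.sum_congr rfl fun j _ => by ring
  · rw [Finset.sum_comm]
    refine Finset.sum_congr rfl fun i _ => Finset.sum_congr rfl fun j _ => by ring

theorem fderiv_quadPoly_apply (y v : Space n) :
    fderiv ℝ (quadPoly σ) y v = ∑ p, grad σ p y * v p := by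
  simp [(hasFDerivAt_quadPoly σ y).fderiv]

/-- Letting p run over all four blocks counts each pairing in both orders, which accounts for the
symmetrised product. -/
theorem metricForm_apply (y v w : Space n) :
    metricForm σ y v w =
      ∑ p, v p * w (dual p) + (∑ p, grad σ p y * v p) * (∑ p, grad σ p y * w p) := by
  have e2 : (2 + 2 : Fin 4) = 0 := rfl
  have e3 : (3 + 2 : Fin 4) = 1 := rfl
  have e1 : (1 + 2 : Fin 4) = 3 := rfl
  simp only [metricForm, covTensor, dx, add_apply,
    sum_apply, ContinuousLinearMap.smulRight_apply,
    smul_apply, PiLp.proj_apply, fderiv_quadPoly_apply, smul_eq_mul]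
  rw [sum_fin_four_prod (fun p => v p * w (dual p))]
  simp only [dual, zero_add, e1, e2, e3, Finset.sum_add_distrib]
  ring

theorem metricForm_comm (y v w : Space n) : metricForm σ y v w = metricForm σ y w v := by
  rw [metricForm_apply, metricForm_apply, mul_comm (∑ p, grad σ p y * v p)]
  congr 1
  -- Reindexing by the involution `dual` exchanges the roles of v and w.
  refine Fintype.sum_equiv ⟨dual, dual, dual_dual, dual_dual⟩ _ _ fun p => ?_
  simp [dual_dual, mul_comm]

/-- The matrix of `metricForm σ y` in the standard basis. -/
def gram (y : Space n) : Matrix (Fin 4 × Fin n) (Fin 4 × Fin n) ℝ :=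
  Matrix.of fun p q => metricForm σ y (EuclideanSpace.single p 1) (EuclideanSpace.single q 1)

theorem gram_apply (y : Space n) (p q : Fin 4 × Fin n) :
    gram σ y p q = (if q = dual p then 1 else 0) + grad σ p y * grad σ q y := by
  simp only [gram, Matrix.of_apply, metricForm_apply, PiLp.single_apply]
  rw [Finset.sum_eq_single p (fun r _ hr => by simp [hr]) (by simp)]
  simp [eq_comm]

theorem gram_isSymm (y : Space n) : (gram σ y).IsSymm := by
  ext p q
  simp [gram, metricForm_comm σ y (EuclideanSpace.single p 1)]

/-- The inverse of `gram σ y`. -/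
def cogram (y : Space n) : Matrix (Fin 4 × Fin n) (Fin 4 × Fin n) ℝ :=
  Matrix.of fun p q => (if q = dual p then 1 else 0) - grad σ (dual p) y * grad σ (dual q) y

/-- The Sherman–Morrison formula for J + ∇q ∇qᵀ; its denominator 1 + ∇qᵀJ∇q equals 1 because the
gradient is null. -/
theorem gram_mul_cogram (y : Space n) : gram σ y * cogram σ y = 1 := by
  ext p q
  have h1 (r : Fin 4 × Fin n) : gram σ y p r * cogram σ y r q =
      (if r = dual p then (if r = dual q then 1 else 0) else 0)
      - (if r = dual p then grad σ (dual r) y * grad σ (dual q) y else 0)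
      + (if r = dual q then grad σ p y * grad σ r y else 0)
      - grad σ p y * grad σ (dual q) y * (grad σ r y * grad σ (dual r) y) := by
    simp only [gram_apply, cogram, Matrix.of_apply, eq_dual_comm (p := r) (q := q)]
    split_ifs <;> ring
  rw [Matrix.mul_apply, Finset.sum_congr rfl fun r _ => h1 r]
  simp only [Finset.sum_add_distrib, Finset.sum_sub_distrib, grad_mul_grad_dual,
    Finset.sum_ite_eq', Finset.mem_univ, if_true, dual_dual, mul_zero, Finset.sum_const_zero,
    Matrix.one_apply]
  have : dual p = dual q ↔ p = q := ⟨fun h => by rw [← dual_dual p, h, dual_dual], fun h => h ▸ rfl⟩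
  simp [this]

theorem isUnit_det_gram (y : Space n) : IsUnit (gram σ y).det :=
  Matrix.isUnit_det_of_right_inverse (gram_mul_cogram σ y)

theorem inv_gram (y : Space n) : (gram σ y)⁻¹ = cogram σ y :=
  Matrix.inv_eq_right_inv (gram_mul_cogram σ y)

/-! ### Christoffel symbols and curvature of g -/

theorem hasFDerivAt_gram (p q : Fin 4 × Fin n) (y : Space n) :
    HasFDerivAt (fun z => gram σ z p q) (grad σ p y • grad σ q + grad σ q y • grad σ p) y := by
  simp only [gram_apply]
  exact (((grad σ p).hasFDerivAt).mul ((grad σ q).hasFDerivAt)).const_add _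

theorem partialDeriv_gram (i p q : Fin 4 × Fin n) (y : Space n) :
    partialDeriv i (fun z => gram σ z p q) y =
      grad σ p y * hess σ q i + grad σ q y * hess σ p i := by
  simp [partialDeriv, (hasFDerivAt_gram σ p q y).fderiv, grad_single]

theorem partialDeriv_grad_mul (i p : Fin 4 × Fin n) (c : ℝ) (y : Space n) :
    partialDeriv i (fun z => grad σ p z * c) y = hess σ p i * c := by
  rw [partialDeriv, (((grad σ p).hasFDerivAt (x := y)).mul_const c).fderiv]
  simp [grad_single, mul_comm]

/-- Only dq ⊗ dq varies, so the symbol with lowered index is q_l q_{ij}. Raising l uses J alone, the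
rank-one part of the inverse contributing zero by nullity. -/
theorem christoffel_gram (k i j : Fin 4 × Fin n) (y : Space n) :
    christoffel (gram σ) k i j y = grad σ (dual k) y * hess σ i j := by
  have h1 (l : Fin 4 × Fin n) : (gram σ y)⁻¹ k l *
      (partialDeriv i (fun z => gram σ z j l) y + partialDeriv j (fun z => gram σ z i l) y
        - partialDeriv l (fun z => gram σ z i j) y) =
      2 * hess σ i j * (if l = dual k then grad σ l y else 0)
      - 2 * hess σ i j * grad σ (dual k) y * (grad σ l y * grad σ (dual l) y) := by
    simp only [inv_gram, cogram, Matrix.of_apply, partialDeriv_gram, hess_comm σ l,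
      hess_comm σ j i]
    split_ifs <;> ring
  rw [christoffel, Finset.sum_congr rfl fun l _ => h1 l, Finset.sum_sub_distrib,
    ← Finset.mul_sum, ← Finset.mul_sum]
  simp [grad_mul_grad_dual]
  ring

theorem curvatureComponent_gram (l k i j : Fin 4 × Fin n) (y : Space n) :
    curvatureComponent (gram σ) l k i j y =
      hess σ (dual l) i * hess σ j k - hess σ (dual l) j * hess σ i k := by
  have hc (p q r : Fin 4 × Fin n) : christoffel (gram σ) p q r =
      fun z => grad σ (dual p) z * hess σ q r := funext fun z => christoffel_gram σ p q r z
  -- Each product of two Christoffel symbols contracts the Hessian with the raised gradient.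
  have hm (p q r s : Fin 4 × Fin n) (m : Fin 4 × Fin n) :
      grad σ (dual p) y * hess σ q m * (grad σ (dual m) y * hess σ r s) = 0 := by
    have := hess_mul_grad_dual σ m q y
    rw [hess_comm] at this
    linear_combination grad σ (dual p) y * hess σ r s * this
  simp only [curvatureComponent, hc, partialDeriv_grad_mul, hm]
  simp

/-- The metric is Ricci-flat. -/
theorem ricciComponent_gram (j k : Fin 4 × Fin n) (y : Space n) :
    ricciComponent (gram σ) j k y = 0 := by
  refine Finset.sum_eq_zero fun i _ => ?_
  rw [curvatureComponent_gram, hess_dual_self, mul_comm (hess σ (dual i) j), hess_mul_hess_dual]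
  simp

/-- A constant factor leaves the Christoffel symbols unchanged. Such factors appear when a
Ricci-flat representative is viewed in a different chart of the quotient. -/
theorem ricciComponent_exp_smul_gram (c : ℝ) (j k : Fin 4 × Fin n) (y : Space n) :
    ricciComponent (fun z => Real.exp (2 * c) • gram σ z) j k y = 0 := by
  have hc (p q r : Fin 4 × Fin n) : christoffel (fun z => Real.exp (2 * c) • gram σ z) p q r =
      christoffel (gram σ) p q r := by
    funext z
    rw [christoffel_conformal (h := fun _ => c)
      (fun p q => (hasFDerivAt_gram σ p q z).differentiableAt) (gram_isSymm σ z)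
      (isUnit_det_gram σ z) (differentiableAt_const c)]
    simp [partialDeriv]
  rw [← ricciComponent_gram σ j k y]
  simp only [ricciComponent, curvatureComponent, hc]

/-! ### Signature of g -/

/-- A frame in which the metric takes the constant values `δ_{q p*}`. -/
def nullFrame (y : Space n) (p : Fin 4 × Fin n) : Space n :=
  WithLp.toLp 2 fun r => (if r = p then 1 else 0) - 1 / 2 * grad σ p y * grad σ (dual r) y

/-- The frame is e_p - ½ q_p J∇q. As dq kills J∇q, the square of dq contributes q_p q_q, and the two
cross terms of J cancel it in halves. -/
theorem metricForm_nullFrame (y : Space n) (p q : Fin 4 × Fin n) :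
    metricForm σ y (nullFrame σ y p) (nullFrame σ y q) = if q = dual p then 1 else 0 := by
  have hD (p : Fin 4 × Fin n) : ∑ r, grad σ r y * nullFrame σ y p r = grad σ p y := by
    have (r : Fin 4 × Fin n) : grad σ r y * nullFrame σ y p r =
        (if r = p then grad σ r y else 0)
          - 1 / 2 * grad σ p y * (grad σ r y * grad σ (dual r) y) := by
      simp only [nullFrame]
      split_ifs <;> ring
    simp [this, grad_mul_grad_dual]
  have hB (r : Fin 4 × Fin n) : nullFrame σ y p r * nullFrame σ y q (dual r) =
      (if r = p then (if dual r = q then 1 else 0) - 1 / 2 * grad σ q y * grad σ r y else 0)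
      - (if r = dual q then 1 / 2 * grad σ p y * grad σ (dual r) y else 0)
      + 1 / 4 * grad σ p y * grad σ q y * (grad σ r y * grad σ (dual r) y) := by
    simp only [nullFrame, dual_dual, eq_dual_comm (p := q) (q := r), eq_comm (a := q)]
    split_ifs <;> ring
  rw [metricForm_apply, hD, hD, Finset.sum_congr rfl fun r _ => hB r]
  simp only [Finset.sum_add_distrib, Finset.sum_sub_distrib, Finset.sum_ite_eq', Finset.mem_univ,
    if_true, grad_mul_grad_dual, dual_dual, mul_zero, Finset.sum_const_zero, eq_comm (a := q)]
  ring

/-- The indices of the first two blocks. -/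
def lowIndex (k : Fin (2 * n)) : Fin 4 × Fin n :=
  (Fin.castLE (by norm_num) (finProdFinEquiv.symm k).1, (finProdFinEquiv.symm k).2)

theorem lowIndex_inj {k l : Fin (2 * n)} : lowIndex k = lowIndex l ↔ k = l := by
  refine ⟨fun h => ?_, fun h => h ▸ rfl⟩
  simp only [lowIndex, Prod.mk.injEq, Fin.castLE_inj] at h
  exact finProdFinEquiv.symm.injective (Prod.ext h.1 h.2)

theorem lowIndex_ne_dual (k l : Fin (2 * n)) : lowIndex k ≠ dual (lowIndex l) := by
  intro h
  have h1 := congrArg (fun p : Fin 4 × Fin n => p.1) h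
  simp only [lowIndex, dual] at h1
  generalize (finProdFinEquiv.symm k).1 = a at h1
  generalize (finProdFinEquiv.symm l).1 = b at h1
  revert a b
  decide

/-- The metric, rescaled by a positive factor, has signature `(2n, 2n)` at each point. -/
theorem exists_orthonormal_basis (y : Space n) (u : ℝ) :
    ∃ b : Module.Basis (Fin (2 * n) ⊕ Fin (2 * n)) ℝ (Space n),
      (∀ i j, i ≠ j → (Real.exp (2 * u) • metricForm σ y) (b i) (b j) = 0) ∧
      (∀ i, (Real.exp (2 * u) • metricForm σ y) (b (Sum.inl i)) (b (Sum.inl i)) = -1) ∧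
      (∀ j, (Real.exp (2 * u) • metricForm σ y) (b (Sum.inr j)) (b (Sum.inr j)) = 1) := by
  set B : Space n →ₗ[ℝ] Space n →ₗ[ℝ] ℝ := LinearMap.mk₂ ℝ
    (fun v w => (Real.exp (2 * u) • metricForm σ y) v w) (by intros; simp)
    (by intros; simp) (by intros; simp [mul_add]) (by intros; simp)
  have hB (v w : Space n) : B v w = Real.exp (2 * u) * metricForm σ y v w := rfl
  -- The sum and difference of a dual pair in the null frame have g-squares 2 and -2; s absorbs this
  -- 2 and the conformal factor.
  set s : ℝ := Real.exp (-u) * (√2)⁻¹ with hs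
  have hss : Real.exp (2 * u) * (s * s) = 1 / 2 := by
    have h2 : (√2)⁻¹ * (√2)⁻¹ = (1 / 2 : ℝ) := by
      rw [← mul_inv, Real.mul_self_sqrt (by norm_num), one_div]
    have h3 : Real.exp (2 * u) * (Real.exp (-u) * Real.exp (-u)) = 1 := by
      rw [← Real.exp_add, ← Real.exp_add, ← Real.exp_zero]
      congr 1
      ring
    rw [hs]
    linear_combination (1 / 2 : ℝ) * h3
      + Real.exp (2 * u) * (Real.exp (-u) * Real.exp (-u)) * h2
  let E (ε : ℝ) (k : Fin (2 * n)) : Space n :=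
    s • (nullFrame σ y (lowIndex k) + ε • nullFrame σ y (dual (lowIndex k)))
  have hE (ε δ : ℝ) (k l : Fin (2 * n)) : B (E ε k) (E δ l) =
      if l = k then (ε + δ) / 2 else 0 := by
    have hinj (k l : Fin (2 * n)) : dual (lowIndex k) = dual (lowIndex l) ↔ k = l :=
      ⟨fun h => lowIndex_inj.1 (by rw [← dual_dual (lowIndex k), h, dual_dual]), fun h => h ▸ rfl⟩
    rw [hB]
    simp only [E, smul_apply, add_apply, map_add, map_smul, metricForm_nullFrame, smul_eq_mul,
      dual_dual, lowIndex_ne_dual, hinj, lowIndex_inj, if_false, (lowIndex_ne_dual _ _).symm]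
    split_ifs
    · linear_combination (ε + δ) * hss
    · ring
  let v : Fin (2 * n) ⊕ Fin (2 * n) → Space n := Sum.elim (E (-1)) (E 1)
  have hortho : ∀ i j, i ≠ j → B (v i) (v j) = 0 := by
    rintro (i | i) (j | j) hij <;> simp only [v, Sum.elim_inl, Sum.elim_inr, hE] <;>
      split_ifs with h <;> simp_all
  have hneg (i) : B (v (Sum.inl i)) (v (Sum.inl i)) = -1 := by simp [v, hE]
  have hpos (i) : B (v (Sum.inr i)) (v (Sum.inr i)) = 1 := by simp [v, hE]
  have hli : LinearIndependent ℝ v := by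
    refine LinearMap.linearIndependent_of_isOrthoᵢ (B := B)
      (LinearMap.isOrthoᵢ_def.2 fun i j hij => hortho i j hij) ?_
    rintro (i | i) <;> simp [hneg, hpos]
  have hcard : Fintype.card (Fin (2 * n) ⊕ Fin (2 * n)) = Module.finrank ℝ (Space n) := by
    simp
    ring
  -- For n = 0 the space is trivial; turning an independent family into a basis requires a nonempty
  -- index type.
  rcases isEmpty_or_nonempty (Fin (2 * n) ⊕ Fin (2 * n)) with hemp | hne
  · have : Module.finrank ℝ (Space n) = 0 := by rw [← hcard]; exact Fintype.card_eq_zero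
    have := Module.finrank_zero_iff.1 this
    exact ⟨Module.Basis.empty _, fun i => hemp.elim i, fun i => hemp.elim (Sum.inl i),
      fun i => hemp.elim (Sum.inl i)⟩
  · refine ⟨basisOfLinearIndependentOfCardEqFinrank hli hcard, ?_⟩
    simp only [coe_basisOfLinearIndependentOfCardEqFinrank]
    exact ⟨hortho, hneg, hpos⟩

/-! ### A conformally invariant curvature component -/

/-- At a point where the gradient of the quadratic polynomial vanishes, a rescaling `e^{2h} g`
has a curvature component that does not depend on `h`. -/
theorem curvatureComponent_exp_smul_gram (h : Space n → ℝ) (y : Space n)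
    (hh : ContDiffAt ℝ ∞ h y) (hy : ∀ p, grad σ p y = 0) (p q : Fin n) :
    curvatureComponent (fun z => Real.exp (2 * h z) • gram σ z) (2, p) (1, q) (1, q) (0, p) y =
      σ p q ^ 2 := by
  -- The symbols get differentiated, so their formula is needed on a neighbourhood and not only at
  -- y.
  have hconf : ∀ᶠ z in 𝓝 y, ∀ k i j,
      christoffel (fun z => Real.exp (2 * h z) • gram σ z) k i j z =
        grad σ (dual k) z * hess σ i j + (if k = j then partialDeriv i h z else 0)
        + (if k = i then partialDeriv j h z else 0)
        - gram σ z i j * ∑ l, (gram σ z)⁻¹ k l * partialDeriv l h z := by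
    have h1 : ∀ᶠ z in 𝓝 y, ContDiffAt ℝ 1 h z :=
      (hh.of_le (by exact_mod_cast le_top)).eventually (by simp)
    filter_upwards [h1] with z hz k i j
    rw [christoffel_conformal (fun p q => (hasFDerivAt_gram σ p q z).differentiableAt)
      (gram_isSymm σ z) (isUnit_det_gram σ z) (hz.differentiableAt one_ne_zero), christoffel_gram]
  have hpd (l : Fin 4 × Fin n) : DifferentiableAt ℝ (partialDeriv l h) y := by
    have h2 : ContDiffAt ℝ 1 (fderiv ℝ h) y :=
      (hh.fderiv_right (m := ∞) le_rfl).of_le (by exact_mod_cast le_top)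
    exact (h2.differentiableAt one_ne_zero).clm_apply (differentiableAt_const _)
  have hS (k : Fin 4 × Fin n) :
      DifferentiableAt ℝ (fun z => ∑ l, (gram σ z)⁻¹ k l * partialDeriv l h z) y := by
    refine DifferentiableAt.fun_sum fun l _ => DifferentiableAt.fun_mul ?_ (hpd l)
    simp only [inv_gram, cogram, Matrix.of_apply]
    exact (differentiableAt_const _).sub
      ((grad σ (dual k)).differentiableAt.mul (grad σ (dual l)).differentiableAt)
  have hne : ((2, p) : Fin 4 × Fin n) ≠ (1, q) := by simp
  have hne' : ((2, p) : Fin 4 × Fin n) ≠ (0, p) := by simp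
  have hd : dual ((2, p) : Fin 4 × Fin n) = (0, p) := rfl
  have hH : hess σ (0, p) (1, q) = σ p q := by simp [hess]
  have hH0 : hess σ (1, q) (1, q) = 0 := by simp [hess]
  have hg (i j : Fin 4 × Fin n) (hij : j ≠ dual i) (z : Space n) :
      gram σ z i j = grad σ i z * grad σ j z := by simp [gram_apply, hij]
  -- Off the dual pairs, the metric coefficient is a product of two gradients and vanishes to second
  -- order at y, so the term containing h has zero derivative there.
  have hd1 (c : ℝ) (i r s : Fin 4 × Fin n) (hrs : s ≠ dual r) :
      partialDeriv i (fun z => grad σ (0, p) z * c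
        - gram σ z r s * ∑ l, (gram σ z)⁻¹ (2, p) l * partialDeriv l h z) y
        = hess σ (0, p) i * c := by
    have e : HasFDerivAt (fun z => grad σ (0, p) z * c
        - gram σ z r s * ∑ l, (gram σ z)⁻¹ (2, p) l * partialDeriv l h z) _ y :=
      (((grad σ (0, p)).hasFDerivAt (x := y)).mul_const c).fun_sub
        ((hasFDerivAt_gram σ r s y).mul (hS (2, p)).hasFDerivAt)
    rw [partialDeriv, e.fderiv]
    simp [hg r s hrs, hy, grad_single, mul_comm]
  have hne01 : ((1, q) : Fin 4 × Fin n) ≠ dual (0, p) := by simp [dual]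
  have hne10 : ((0, p) : Fin 4 × Fin n) ≠ dual (1, q) := by simp [dual]
  have hne11 : ((1, q) : Fin 4 × Fin n) ≠ dual (1, q) := by simp [dual]
  have e1 : partialDeriv (1, q)
      (christoffel (fun z => Real.exp (2 * h z) • gram σ z) (2, p) (0, p) (1, q)) y =
      hess σ (0, p) (1, q) * σ p q := by
    rw [← hd1 _ _ _ _ hne01]
    exact partialDeriv_congr (hconf.mono fun z hz => by simp [hz, hne, hne', hd, hH])
  have e2 : partialDeriv (0, p)
      (christoffel (fun z => Real.exp (2 * h z) • gram σ z) (2, p) (1, q) (1, q)) y =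
      hess σ (0, p) (0, p) * 0 := by
    rw [← hd1 _ _ _ _ hne11]
    exact partialDeriv_congr (hconf.mono fun z hz => by simp [hz, hne, hd, hH0])
  rw [curvatureComponent, e1, e2, hH]
  -- At y only Kronecker deltas can survive in the second factors, forcing m to be (1,q) or (0,p);
  -- the first factor is then zero, its upper index (2,p) matching neither lower index.
  have hsum : ∀ m, christoffel (fun z => Real.exp (2 * h z) • gram σ z) (2, p) (1, q) m y *
        christoffel (fun z => Real.exp (2 * h z) • gram σ z) m (0, p) (1, q) y
      - christoffel (fun z => Real.exp (2 * h z) • gram σ z) (2, p) (0, p) m y *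
        christoffel (fun z => Real.exp (2 * h z) • gram σ z) m (1, q) (1, q) y = 0 := by
    intro m
    simp only [hconf.self_of_nhds, hy, hg _ _ hne01, hg _ _ hne11, hne, hne', if_false]
    by_cases h1 : m = (1, q)
    · subst h1
      simp [hne, hg _ _ hne01, hg _ _ hne11, hy]
    · by_cases h2 : m = (0, p)
      · subst h2
        simp [hne', hg _ _ hne10, hy]
      · simp [h1, h2]
  rw [Finset.sum_eq_zero fun m _ => hsum m]
  ring

end Coordinates

/-! ### The flow of dilations and its time function -/

section Flow

variable {n : ℕ}

theorem scaling_apply (a b : ℝ) (x : Space n) (p : Fin 4 × Fin n) :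
    scaling n a b x p = Real.exp (weight a b p.1) * x p := rfl

theorem weight_add (a b c d : ℝ) (k : Fin 4) :
    weight (a + c) (b + d) k = weight a b k + weight c d k := by
  fin_cases k <;> simp [weight] <;> ring

theorem weight_mul (t a b : ℝ) (k : Fin 4) : weight (t * a) (t * b) k = t * weight a b k := by
  fin_cases k <;> simp [weight] <;> ring

theorem weight_pos {a b : ℝ} (ha : 0 < a) (hb : 0 < b) (k : Fin 4) : 0 < weight a b k := by
  fin_cases k <;> simp [weight] <;> positivity

theorem scaling_scaling (a b c d : ℝ) (x : Space n) :
    scaling n a b (scaling n c d x) = scaling n (a + c) (b + d) x := by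
  ext p
  rw [scaling_apply, scaling_apply, scaling_apply, weight_add, Real.exp_add, mul_assoc]

theorem scaling_zero (x : Space n) : scaling n 0 0 x = x := by
  ext ⟨k, i⟩
  rw [scaling_apply]
  fin_cases k <;> simp [weight]

theorem scaling_ne_zero (a b : ℝ) {x : Space n} (hx : x ≠ 0) : scaling n a b x ≠ 0 :=
  (LinearEquiv.map_ne_zero_iff _).2 hx

theorem contDiff_scaling (a b : ℝ) : ContDiff ℝ ∞ (scaling n a b) :=
  (scaling n a b).toContinuousLinearEquiv.contDiff

/-- The time-`t` map of the flow through `φ_{a,b}`. -/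
def flow (a b t : ℝ) (x : Space n) : Space n := scaling n (t * a) (t * b) x

theorem flow_flow (a b s t : ℝ) (x : Space n) : flow a b s (flow a b t x) = flow a b (s + t) x := by
  rw [flow, flow, flow, scaling_scaling, add_mul, add_mul]

theorem flow_zero (a b : ℝ) (x : Space n) : flow a b 0 x = x := by
  rw [flow, zero_mul, zero_mul, scaling_zero]

theorem flow_ne_zero (a b t : ℝ) {x : Space n} (hx : x ≠ 0) : flow a b t x ≠ 0 :=
  scaling_ne_zero _ _ hx

theorem flow_scaling (a b t c d : ℝ) (x : Space n) :
    flow a b t (scaling n c d x) = scaling n c d (flow a b t x) := by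
  rw [flow, flow, scaling_scaling, scaling_scaling, add_comm c, add_comm d]

theorem contDiff_flow_uncurry (a b : ℝ) :
    ContDiff ℝ ∞ fun q : Space n × ℝ => flow a b q.2 q.1 := by
  rw [contDiff_euclidean]
  intro p
  simp only [flow, scaling_apply, weight_mul]
  fun_prop

theorem contDiff_flow (a b t : ℝ) : ContDiff ℝ ∞ (flow a b t : Space n → Space n) :=
  contDiff_scaling _ _

/-- The squared norm of the time-`(-t)` image of `x`. -/
def levelFun (a b : ℝ) (x : Space n) (t : ℝ) : ℝ :=
  ∑ p, Real.exp (-(2 * weight a b p.1) * t) * x p ^ 2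

theorem norm_flow_neg_sq (a b t : ℝ) (x : Space n) : ‖flow a b (-t) x‖ ^ 2 = levelFun a b x t := by
  rw [EuclideanSpace.norm_sq_eq, levelFun]
  refine Finset.sum_congr rfl fun p _ => ?_
  rw [flow, scaling_apply, Real.norm_eq_abs, sq_abs, mul_pow, weight_mul, ← Real.exp_nat_mul]
  congr 2
  push_cast
  ring

theorem norm_flow_neg_eq_one_iff (a b t : ℝ) (x : Space n) :
    ‖flow a b (-t) x‖ = 1 ↔ levelFun a b x t = 1 := by
  rw [← norm_flow_neg_sq, pow_eq_one_iff_of_nonneg (norm_nonneg _) two_ne_zero]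

theorem exists_coord_ne_zero {x : Space n} (hx : x ≠ 0) : ∃ p, x p ≠ 0 := by
  by_contra! h
  exact hx (by ext p; simpa using h p)

theorem hasDerivAt_levelFun (a b : ℝ) (x : Space n) (t : ℝ) :
    HasDerivAt (levelFun a b x)
      (-∑ p, 2 * weight a b p.1 * (Real.exp (-(2 * weight a b p.1) * t) * x p ^ 2)) t := by
  rw [← Finset.sum_neg_distrib]
  refine HasDerivAt.fun_sum fun p _ => ?_
  convert! (((hasDerivAt_id t).const_mul (-(2 * weight a b p.1))).exp.mul_const (x p ^ 2)) using 1
  simp only [id]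
  ring

theorem contDiff_levelFun_uncurry (a b : ℝ) :
    ContDiff ℝ ∞ fun q : Space n × ℝ => levelFun a b q.1 q.2 := by
  unfold levelFun
  fun_prop

variable {a b : ℝ}

theorem levelFun_deriv_neg (ha : 0 < a) (hb : 0 < b) {x : Space n} (hx : x ≠ 0) (t : ℝ) :
    -∑ p, 2 * weight a b p.1 * (Real.exp (-(2 * weight a b p.1) * t) * x p ^ 2) < 0 := by
  obtain ⟨p, hp⟩ := exists_coord_ne_zero hx
  rw [neg_neg_iff_pos]
  refine Finset.sum_pos' (fun q _ => ?_) ⟨p, Finset.mem_univ _, ?_⟩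
  · have := weight_pos ha hb q.1
    positivity
  · have := weight_pos ha hb p.1
    positivity

theorem strictAnti_levelFun (ha : 0 < a) (hb : 0 < b) {x : Space n} (hx : x ≠ 0) :
    StrictAnti (levelFun a b x) :=
  strictAnti_of_hasDerivAt_neg (hasDerivAt_levelFun a b x) (levelFun_deriv_neg ha hb hx)

/-- Intermediate value theorem: the function tends to 0 at +∞, and to +∞ at -∞ because of a single
nonzero coordinate. -/
theorem exists_levelFun_eq_one (ha : 0 < a) (hb : 0 < b) {x : Space n} (hx : x ≠ 0) :
    ∃ t, levelFun a b x t = 1 := by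
  have hcont : Continuous (levelFun a b x) :=
    continuous_iff_continuousAt.2 fun t => (hasDerivAt_levelFun a b x t).continuousAt
  have htop : Filter.Tendsto (levelFun a b x) Filter.atTop (𝓝 0) := by
    rw [← Finset.sum_const_zero (s := (Finset.univ : Finset (Fin 4 × Fin n)))]
    refine tendsto_finsetSum _ fun p _ => ?_
    rw [← zero_mul (x p ^ 2)]
    refine (Real.tendsto_exp_atBot.comp ?_).mul_const _
    exact Filter.tendsto_id.const_mul_atTop_of_neg (by linarith [weight_pos ha hb p.1])
  have hbot : Filter.Tendsto (levelFun a b x) Filter.atBot Filter.atTop := by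
    obtain ⟨p, hp⟩ := exists_coord_ne_zero hx
    have h1 : Filter.Tendsto (fun t => Real.exp (-(2 * weight a b p.1) * t) * x p ^ 2)
        Filter.atBot Filter.atTop := by
      refine Filter.Tendsto.atTop_mul_const (by positivity) (Real.tendsto_exp_atTop.comp ?_)
      exact Filter.tendsto_id.const_mul_atBot_of_neg (by linarith [weight_pos ha hb p.1])
    refine Filter.tendsto_atTop_mono (fun t => ?_) h1
    exact Finset.single_le_sum (f := fun p => Real.exp (-(2 * weight a b p.1) * t) * x p ^ 2)
      (fun q _ => by positivity) (Finset.mem_univ p)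
  obtain ⟨t₁, h₁⟩ := (htop.eventually (gt_mem_nhds one_pos)).exists
  obtain ⟨t₂, h₂⟩ := (hbot.eventually (Filter.eventually_ge_atTop 1)).exists
  exact mem_range_of_exists_le_of_exists_ge hcont ⟨t₁, h₁.le⟩ ⟨t₂, h₂⟩

/-- The time at which the orbit of the unit sphere under the flow passes through `x`. -/
def time (a b : ℝ) (x : Space n) : ℝ := Function.invFun (levelFun a b x) 1

variable [ha : Fact (0 < a)] [hb : Fact (0 < b)]

theorem levelFun_time {x : Space n} (hx : x ≠ 0) : levelFun a b x (time a b x) = 1 :=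
  Function.invFun_eq (exists_levelFun_eq_one ha.out hb.out hx)

theorem time_eq {x : Space n} (hx : x ≠ 0) {t : ℝ} (ht : levelFun a b x t = 1) :
    time a b x = t :=
  (strictAnti_levelFun ha.out hb.out hx).injective ((levelFun_time hx).trans ht.symm)

theorem norm_flow_neg_time {x : Space n} (hx : x ≠ 0) : ‖flow a b (-time a b x) x‖ = 1 :=
  (norm_flow_neg_eq_one_iff _ _ _ _).2 (levelFun_time hx)

theorem time_eq_zero {x : Space n} (hx : ‖x‖ = 1) : time a b x = 0 := by
  refine time_eq (norm_pos_iff.1 (by rw [hx]; exact one_pos))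
    ((norm_flow_neg_eq_one_iff _ _ _ _).1 ?_)
  rw [neg_zero, flow_zero, hx]

/-- Flowing back by the sum of the two times lands on the unit sphere, and that time is unique. -/
theorem time_flow (s : ℝ) {x : Space n} (hx : x ≠ 0) :
    time a b (flow a b s x) = time a b x + s := by
  refine time_eq (flow_ne_zero _ _ _ hx) ((norm_flow_neg_eq_one_iff _ _ _ _).1 ?_)
  rw [flow_flow, ← norm_flow_neg_time (a := a) (b := b) hx]
  congr 2
  ring

/-- Implicit function theorem for `levelFun` = 1, whose t-derivative is strictly negative;
uniqueness of the root identifies the implicit function with `time`. -/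
theorem contDiffAt_time {x : Space n} (hx : x ≠ 0) : ContDiffAt ℝ ∞ (time a b) x := by
  have hf := (contDiff_levelFun_uncurry (n := n) a b).contDiffAt (x := (x, time a b x))
  have hfd := (hf.differentiableAt (by simp)).hasFDerivAt
  have hpart : HasDerivAt (levelFun a b x)
      (fderiv ℝ (fun q : Space n × ℝ => levelFun a b q.1 q.2) (x, time a b x) (0, 1))
      (time a b x) := by
    have h := hfd.comp_hasDerivAt (time a b x)
      ((hasDerivAt_const (time a b x) x).prodMk (hasDerivAt_id (time a b x)))
    exact h
  have hc := levelFun_deriv_neg ha.out hb.out hx (time a b x)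
  set c := fderiv ℝ (fun q : Space n × ℝ => levelFun a b q.1 q.2) (x, time a b x) (0, 1) with hcd
  have hc0 : c ≠ 0 := by
    rw [hpart.unique (hasDerivAt_levelFun a b x (time a b x))]
    exact hc.ne
  have hinv : (fderiv ℝ (fun q : Space n × ℝ => levelFun a b q.1 q.2) (x, time a b x) ∘L
      .inr ℝ (Space n) ℝ).IsInvertible := by
    refine ContinuousLinearMap.IsInvertible.of_inverse
      (g := c⁻¹ • ContinuousLinearMap.id ℝ ℝ) ?_ ?_ <;> ext <;> simp [← hcd, hc0]
  refine (hf.contDiffAt_implicitFunction (by simp) hinv).congr_of_eventuallyEq ?_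
  filter_upwards [hf.eventually_apply_implicitFunction (by simp) hinv,
    isOpen_ne.mem_nhds hx] with z hz hz0
  exact time_eq hz0 (hz.trans (levelFun_time hx))

/-- The logarithmic conformal factor: `e^{2u} g` is invariant under `φ_{a,b}`. -/
def logFactor (a b : ℝ) (x : Space n) : ℝ := -(a + b) * time a b x

theorem contDiffAt_logFactor {x : Space n} (hx : x ≠ 0) : ContDiffAt ℝ ∞ (logFactor a b) x :=
  contDiffAt_const.mul (contDiffAt_time hx)

theorem logFactor_flow (s : ℝ) {x : Space n} (hx : x ≠ 0) :
    logFactor a b (flow a b s x) = logFactor a b x - s * (a + b) := by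
  rw [logFactor, logFactor, time_flow s hx]
  ring

end Flow

/-! ### Homothety and smoothness of the metric on the cover -/

section ScalingMetric

variable {n : ℕ} (σ : Matrix (Fin n) (Fin n) ℝ)

theorem quadPoly_scaling (a b : ℝ) (x : Space n) :
    quadPoly σ (scaling n a b x) = Real.exp (a + b) * quadPoly σ x := by
  simp only [quadPoly, scaling_apply, weight, Finset.mul_sum, Real.exp_add]
  refine Finset.sum_congr rfl fun i _ => Finset.sum_congr rfl fun j _ => ?_
  simp
  ring

/-- The maps `φ_{a,b}` are homotheties. -/
theorem metricForm_scaling (a b : ℝ) (x v w : Space n) :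
    metricForm σ (scaling n a b x) (scaling n a b v) (scaling n a b w) =
      Real.exp (2 * (a + b)) * metricForm σ x v w := by
  -- Obtained by differentiating q ∘ φ = e^{a+b} q in two ways.
  have hq (v : Space n) : ∑ p : Fin 4 × Fin n, grad σ p (scaling n a b x) * scaling n a b v p =
      Real.exp (a + b) * ∑ p, grad σ p x * v p := by
    have h1 : HasFDerivAt (fun y => quadPoly σ (scaling n a b y)) _ x :=
      (hasFDerivAt_quadPoly σ (scaling n a b x)).comp x
        (scaling n a b).toContinuousLinearEquiv.hasFDerivAt
    have h2 : HasFDerivAt (fun y => quadPoly σ (scaling n a b y)) _ x :=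
      ((hasFDerivAt_quadPoly σ x).const_mul (Real.exp (a + b))).congr_of_eventuallyEq
        (Filter.Eventually.of_forall fun y => quadPoly_scaling σ a b y)
    simpa using congrArg (fun L : Space n →L[ℝ] ℝ => L v) (h1.unique h2)
  -- The exponents of dual blocks add up to 2(a+b); this is what dictates the weights a+2b and 2a+b.
  have hw (p : Fin 4 × Fin n) : weight a b p.1 + weight a b (dual p).1 = 2 * (a + b) := by
    obtain ⟨k, i⟩ := p
    fin_cases k <;> simp [weight, dual] <;> ring
  rw [metricForm_apply, metricForm_apply, hq, hq, mul_add,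
    Finset.mul_sum Finset.univ (fun p => v p * w (dual p))]
  congr 1
  · refine Finset.sum_congr rfl fun p _ => ?_
    rw [scaling_apply, scaling_apply, ← hw p, Real.exp_add]
    ring
  · rw [two_mul, Real.exp_add (a + b)]
    ring

theorem contDiff_metricForm : ContDiff ℝ ∞ (metricForm σ) := by
  have h : ContDiff ℝ ∞ (fderiv ℝ (quadPoly σ)) := by
    have : ContDiff ℝ ∞ (quadPoly σ) := by
      unfold quadPoly
      fun_prop
    exact this.fderiv_right le_rfl
  have : ContDiff ℝ ∞ fun x => covTensor (fderiv ℝ (quadPoly σ) x) (fderiv ℝ (quadPoly σ) x) :=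
    h.smulRight h
  exact contDiff_const.add this

end ScalingMetric

/-! ### The smooth structure on the quotient -/

section Quotient

variable {n : ℕ} {a b : ℝ}

theorem coe_zpow_scalingPerm (k : ℤ) (x : punctured n) :
    ((scalingPerm n a b ^ k) x : Space n) = flow a b k (x : Space n) := by
  have h1 (x : punctured n) : (scalingPerm n a b x : Space n) = flow a b 1 (x : Space n) := by
    rw [flow, one_mul, one_mul]
    rfl
  induction k generalizing x with
  | zero => simp [flow_zero]
  | succ m ih =>
    rw [zpow_add_one, Equiv.Perm.mul_apply, ih, h1, flow_flow]
    push_cast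
    rfl
  | pred m ih =>
    have h2 : ((scalingPerm n a b)⁻¹ x : Space n) = flow a b (-1) (x : Space n) := by
      rw [← flow_zero a b ((scalingPerm n a b)⁻¹ x : Space n), ← neg_add_cancel (1 : ℝ),
        ← flow_flow, ← h1, ← Equiv.Perm.mul_apply, mul_inv_cancel, Equiv.Perm.one_apply]
    rw [zpow_sub_one, Equiv.Perm.mul_apply, ih, h2, flow_flow]
    push_cast
    rfl

theorem proj_eq_proj_iff {x y : punctured n} :
    proj n a b x = proj n a b y ↔ ∃ k : ℤ, flow a b k (y : Space n) = x := by
  rw [proj, proj, Quotient.eq, MulAction.orbitRel_apply, MulAction.mem_orbit_iff]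
  constructor
  · rintro ⟨⟨_, k, rfl⟩, hg⟩
    exact ⟨k, by rw [← coe_zpow_scalingPerm, ← hg]; rfl⟩
  · rintro ⟨k, hk⟩
    exact ⟨⟨_, k, rfl⟩, Subtype.ext ((coe_zpow_scalingPerm k y).trans hk)⟩

theorem proj_surjective : Function.Surjective (proj n a b) := Quotient.mk_surjective

theorem continuous_proj : Continuous (proj n a b) := continuous_quotient_mk'

instance : ContinuousConstSMul (Subgroup.zpowers (scalingPerm n a b)) (punctured n) where
  continuous_const_smul := by
    rintro ⟨_, k, rfl⟩
    refine continuous_induced_rng.2 ?_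
    have : (Subtype.val ∘ fun x : punctured n => (scalingPerm n a b ^ k) x) =
        fun x : punctured n => flow a b k (x : Space n) :=
      funext fun x => coe_zpow_scalingPerm k x
    change Continuous (Subtype.val ∘ fun x : punctured n => (scalingPerm n a b ^ k) x)
    rw [this]
    exact (contDiff_flow a b k).continuous.comp continuous_subtype_val

theorem isOpenMap_proj : IsOpenMap (proj n a b) :=
  isOpenMap_quotient_mk'_mul

variable [NeZero n]

/-- A point of `ℝ^{4n} ∖ {0}` in the third block. -/
def basePoint (n : ℕ) [NeZero n] : punctured n :=
  ⟨EuclideanSpace.single (2, 0) 1, fun h => one_ne_zero ((PiLp.single_eq_zero_iff 2 _).1 h)⟩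

open Classical in
/-- A retraction of `ℝ^{4n}` onto `ℝ^{4n} ∖ {0}`. -/
def toPunctured (y : Space n) : punctured n := if h : y ≠ 0 then ⟨y, h⟩ else basePoint n

theorem coe_toPunctured {y : Space n} (hy : y ≠ 0) : (toPunctured y : Space n) = y := by
  rw [toPunctured, dif_pos hy]

theorem toPunctured_coe (x : punctured n) : toPunctured (x : Space n) = x :=
  Subtype.ext (coe_toPunctured x.2)

variable (a b) in
/-- The projection, extended to the whole of `ℝ^{4n}`. -/
def projExt (y : Space n) : QuotientSpace n a b := proj n a b (toPunctured y)

theorem projExt_coe (x : punctured n) : projExt a b (x : Space n) = proj n a b x := by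
  rw [projExt, toPunctured_coe]

theorem projExt_eq_projExt_iff {x y : Space n} (hx : x ≠ 0) (hy : y ≠ 0) :
    projExt a b x = projExt a b y ↔ ∃ k : ℤ, flow a b k y = x := by
  rw [projExt, projExt, proj_eq_proj_iff, coe_toPunctured hx, coe_toPunctured hy]

theorem projExt_flow (k : ℤ) {y : Space n} (hy : y ≠ 0) :
    projExt a b (flow a b k y) = projExt a b y :=
  (projExt_eq_projExt_iff (flow_ne_zero _ _ _ hy) hy).2 ⟨k, rfl⟩

theorem exists_projExt_eq (q : QuotientSpace n a b) : ∃ y, y ≠ 0 ∧ projExt a b y = q := by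
  obtain ⟨x, rfl⟩ := proj_surjective q
  exact ⟨x, x.2, projExt_coe x⟩

variable (n a b) in
/-- The slab of points whose time differs from `τ` by less than `1 / 2`: a fundamental domain up
to its boundary. -/
def slab (τ : ℝ) : Set (Space n) := {y | y ≠ 0 ∧ |time a b y - τ| < 1 / 2}

omit [NeZero n] in
theorem ne_zero_of_mem_slab {τ : ℝ} {y : Space n} (hy : y ∈ slab n a b τ) : y ≠ 0 := hy.1

omit [NeZero n] in
theorem mem_slab_time {y : Space n} (hy : y ≠ 0) : y ∈ slab n a b (time a b y) :=
  ⟨hy, by simp⟩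

theorem domRestrict_projExt (τ : ℝ) : (slab n a b τ).domRestrict (projExt a b) =
    proj n a b ∘ Set.inclusion (fun _ => ne_zero_of_mem_slab) := by
  ext y
  exact projExt_coe (⟨y, y.2.1⟩ : punctured n)

variable [ha : Fact (0 < a)] [hb : Fact (0 < b)]

omit [NeZero n] in
theorem isOpen_slab (τ : ℝ) : IsOpen (slab n a b τ) := by
  refine isOpen_iff_mem_nhds.2 fun y hy => ?_
  filter_upwards [isOpen_ne.mem_nhds hy.1, ((contDiffAt_time (a := a) (b := b)
    hy.1).continuousAt.sub_const τ).abs.eventually (gt_mem_nhds hy.2)] with z h1 h2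
  exact ⟨h1, h2⟩

/-- Equivalent points have times differing by an integer, whereas times within a slab differ by less
than 1. -/
theorem injOn_projExt_slab (τ : ℝ) : Set.InjOn (projExt a b) (slab n a b τ) := by
  intro x hx y hy h
  obtain ⟨k, hk⟩ := (projExt_eq_projExt_iff hx.1 hy.1).1 h
  have h1 := hx.2
  have h2 := hy.2
  rw [← hk, time_flow _ hy.1] at h1
  have h3 : |(k : ℝ)| < 1 := by
    have h4 := abs_sub (time a b y + k - τ) (time a b y - τ)
    have h5 : time a b y + k - τ - (time a b y - τ) = k := by ring
    rw [h5] at h4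
    linarith
  have h0 : k = 0 := by
    rw [← Int.cast_abs] at h3
    exact Int.abs_lt_one_iff.1 (by exact_mod_cast h3)
  rw [← hk, h0, Int.cast_zero, flow_zero]

variable (n a b) in
/-- The chart inverse to the projection on a slab. -/
def slabChart (τ : ℝ) : OpenPartialHomeomorph (QuotientSpace n a b) (Space n) :=
  (OpenPartialHomeomorph.ofContinuousOpenRestrict
    ((injOn_projExt_slab (a := a) (b := b) τ).toPartialEquiv (projExt a b) (slab n a b τ))
    (by
      refine continuousOn_iff_continuous_domRestrict.2 ?_
      change Continuous ((slab n a b τ).domRestrict (projExt a b))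
      rw [domRestrict_projExt]
      exact continuous_proj.comp (continuous_inclusion _))
    (by
      change IsOpenMap ((slab n a b τ).domRestrict (projExt a b))
      rw [domRestrict_projExt]
      refine isOpenMap_proj.comp ?_
      exact ((punctured n).isOpen.isOpenEmbedding_subtypeVal.of_comp _
        (isOpen_slab τ).isOpenEmbedding_subtypeVal).isOpenMap)
    (isOpen_slab τ)).symm

theorem projExt_mem_source {τ : ℝ} {y : Space n} (hy : y ∈ slab n a b τ) :
    projExt a b y ∈ (slabChart n a b τ).source := (slabChart n a b τ).map_target hy

theorem slabChart_projExt {τ : ℝ} {y : Space n} (hy : y ∈ slab n a b τ) :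
    slabChart n a b τ (projExt a b y) = y := (slabChart n a b τ).right_inv hy

theorem slabChart_mem {τ : ℝ} {q : QuotientSpace n a b} (hq : q ∈ (slabChart n a b τ).source) :
    slabChart n a b τ q ∈ slab n a b τ := (slabChart n a b τ).map_source hq

theorem projExt_slabChart {τ : ℝ} {q : QuotientSpace n a b}
    (hq : q ∈ (slabChart n a b τ).source) : projExt a b (slabChart n a b τ q) = q :=
  (slabChart n a b τ).left_inv hq

/-- In every chart, the projection is locally given by a power of `φ_{a,b}`. -/
theorem slabChart_projExt_eventuallyEq {τ : ℝ} {y : Space n} (hy : y ≠ 0)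
    (hs : projExt a b y ∈ (slabChart n a b τ).source) :
    ∃ k : ℤ, ∀ᶠ z in 𝓝 y, z ≠ 0 ∧ slabChart n a b τ (projExt a b z) = flow a b k z := by
  have hm := slabChart_mem hs
  -- The power k found at y also works nearby, because the slab is open.
  obtain ⟨k, hk⟩ := (projExt_eq_projExt_iff hm.1 hy).1 (projExt_slabChart hs)
  refine ⟨k, ?_⟩
  have h1 : ∀ᶠ z in 𝓝 y, flow a b k z ∈ slab n a b τ :=
    (contDiff_flow a b k).continuous.continuousAt.eventually_mem
      ((isOpen_slab τ).mem_nhds (by rwa [hk]))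
  filter_upwards [h1, isOpen_ne.mem_nhds hy] with z hz hz0
  rw [← projExt_flow k hz0, slabChart_projExt hz]
  exact ⟨hz0, rfl⟩

/-- The preferred chart uses the slab centred at the time of a representative, which therefore lies
inside it. -/
instance : ChartedSpace (Space n) (QuotientSpace n a b) where
  atlas := Set.range (slabChart n a b)
  chartAt q := slabChart n a b (time a b (q.out : Space n))
  mem_chart_source q := by
    have h := projExt_mem_source (mem_slab_time (a := a) (b := b) q.out.2)
    rw [projExt_coe] at h
    have h2 : proj n a b q.out = q := Quotient.out_eq q
    rwa [h2] at h
  chart_mem_atlas q := ⟨_, rfl⟩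

theorem slabChart_mem_atlas (τ : ℝ) :
    slabChart n a b τ ∈ atlas (Space n) (QuotientSpace n a b) := ⟨τ, rfl⟩

instance : IsManifold 𝓘(ℝ, Space n) ∞ (QuotientSpace n a b) := by
  refine isManifold_of_contDiffOn _ _ _ ?_
  rintro _ _ ⟨τ, rfl⟩ ⟨τ', rfl⟩ y ⟨⟨hy, hy'⟩, -⟩
  obtain ⟨k, hk⟩ := slabChart_projExt_eventuallyEq (τ := τ') (ne_zero_of_mem_slab hy) hy'
  refine ContDiffAt.contDiffWithinAt ?_
  exact (contDiff_flow a b k).contDiffAt.congr_of_eventuallyEq (hk.mono fun z hz => hz.2)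

theorem slabChart_mem_maximalAtlas (τ : ℝ) :
    slabChart n a b τ ∈ IsManifold.maximalAtlas 𝓘(ℝ, Space n) ∞ (QuotientSpace n a b) :=
  IsManifold.subset_maximalAtlas (slabChart_mem_atlas τ)

theorem contMDiffOn_slabChart (τ : ℝ) : ContMDiffOn 𝓘(ℝ, Space n) 𝓘(ℝ, Space n) ∞
    (slabChart n a b τ) (slabChart n a b τ).source :=
  contMDiffOn_of_mem_maximalAtlas (slabChart_mem_maximalAtlas τ)

theorem contMDiffAt_projExt {y : Space n} (hy : y ≠ 0) :
    ContMDiffAt 𝓘(ℝ, Space n) 𝓘(ℝ, Space n) ∞ (projExt a b) y :=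
  (contMDiffOn_symm_of_mem_maximalAtlas (slabChart_mem_maximalAtlas (time a b y))).contMDiffAt
    ((isOpen_slab _).mem_nhds (mem_slab_time hy))

theorem contMDiff_proj : ContMDiff 𝓘(ℝ, Space n) 𝓘(ℝ, Space n) ∞ (proj n a b) := by
  intro x
  have h : proj n a b = projExt a b ∘ Subtype.val := funext fun x => (projExt_coe x).symm
  rw [h]
  exact (contMDiffAt_projExt x.2).comp x (contMDiff_subtype_val x)

theorem isLocalDiffeomorph_proj :
    IsLocalDiffeomorph 𝓘(ℝ, Space n) 𝓘(ℝ, Space n) ∞ (proj n a b) := by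
  intro x
  refine ⟨{ toFun := proj n a b
            invFun := fun q => toPunctured (slabChart n a b (time a b (x : Space n)) q)
            source := Subtype.val ⁻¹' slab n a b (time a b (x : Space n))
            target := (slabChart n a b (time a b (x : Space n))).source
            map_source' := fun y hy => by
              rw [← projExt_coe]
              exact projExt_mem_source hy
            map_target' := fun q hq => by
              rw [Set.mem_preimage, coe_toPunctured (slabChart_mem hq).1]
              exact slabChart_mem hq
            left_inv' := fun y hy => by
              rw [← projExt_coe, slabChart_projExt hy, toPunctured_coe]
            right_inv' := fun q hq => projExt_slabChart hq
            open_source := (isOpen_slab _).preimage continuous_subtype_val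
            open_target := (slabChart n a b _).open_source
            contMDiffOn_toFun := contMDiff_proj.contMDiffOn
            contMDiffOn_invFun := fun q hq => ?_ }, mem_slab_time x.2, fun _ _ => rfl⟩
  rw [← ContMDiffWithinAt.subtypeVal_comp_iff]
  exact ((contMDiffOn_slabChart _) q hq).congr
    (fun q' hq' => coe_toPunctured (slabChart_mem hq').1) (coe_toPunctured (slabChart_mem hq).1)

/-- A map out of the quotient is smooth if its composition with the projection is. -/
theorem contMDiff_of_comp_projExt {E : Type*} [NormedAddCommGroup E] [NormedSpace ℝ E]
    {H : Type*} [TopologicalSpace H] {J : ModelWithCorners ℝ E H} {N : Type*}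
    [TopologicalSpace N] [ChartedSpace H N] {f : QuotientSpace n a b → N}
    (hf : ∀ y : Space n, y ≠ 0 → ContMDiffAt 𝓘(ℝ, Space n) J ∞ (fun y => f (projExt a b y)) y) :
    ContMDiff 𝓘(ℝ, Space n) J ∞ f := by
  intro q
  obtain ⟨y, hy, rfl⟩ := exists_projExt_eq q
  have hs := projExt_mem_source (mem_slab_time (a := a) (b := b) hy)
  have hnhds := (slabChart n a b (time a b y)).open_source.mem_nhds hs
  have h1 := (contMDiffOn_slabChart (a := a) (b := b) (time a b y)).contMDiffAt hnhds
  have h2 := ContMDiffAt.comp_of_eq (hf y hy) h1 (slabChart_projExt (mem_slab_time hy))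
  refine h2.congr_of_eventuallyEq ?_
  filter_upwards [hnhds] with q hq
  simp [projExt_slabChart hq]

/-! #### Derivatives of the projection -/

/-- The flow as a linear equivalence. -/
def flowEquiv (n : ℕ) (a b t : ℝ) : Space n ≃L[ℝ] Space n :=
  (scaling n (t * a) (t * b)).toContinuousLinearEquiv

/-- The derivative of the projection, in the coordinates of the preferred chart at the image, is a
power of `φ_{a,b}`. -/
theorem exists_hasMFDerivAt_projExt {y : Space n} (hy : y ≠ 0) :
    ∃ k : ℤ, chartAt (Space n) (projExt a b y) (projExt a b y) = flow a b k y ∧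
      HasMFDerivAt 𝓘(ℝ, Space n) 𝓘(ℝ, Space n) (projExt a b) y
        (flowEquiv n a b k : Space n →L[ℝ] Space n) := by
  obtain ⟨k, hk⟩ := slabChart_projExt_eventuallyEq hy
    (mem_chart_source (Space n) (projExt a b y))
  refine ⟨k, hk.self_of_nhds.2, (contMDiffAt_projExt hy).continuousAt, ?_⟩
  have h1 : HasFDerivAt (fun z => chartAt (Space n) (projExt a b y) (projExt a b z))
      (flowEquiv n a b k : Space n →L[ℝ] Space n) y :=
    (flowEquiv n a b k).hasFDerivAt.congr_of_eventuallyEq (hk.mono fun z hz => hz.2)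
  exact h1.hasFDerivWithinAt

omit [NeZero n] in
theorem hasMFDerivAt_subtype_val (x : punctured n) :
    HasMFDerivAt 𝓘(ℝ, Space n) 𝓘(ℝ, Space n) (Subtype.val : punctured n → Space n) x
      (ContinuousLinearMap.id ℝ (Space n)) := by
  refine ⟨continuous_subtype_val.continuousAt, ?_⟩
  have h := TopologicalSpace.Opens.chartAt_subtype_val_symm_eventuallyEq (H := Space n)
    (punctured n) (x := x)
  have h1 : HasFDerivAt (fun z => ((chartAt (Space n) x).symm z : Space n))
      (ContinuousLinearMap.id ℝ (Space n)) (x : Space n) :=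
    (hasFDerivAt_id (x : Space n)).congr_of_eventuallyEq h.symm
  exact h1.hasFDerivWithinAt

theorem mfderiv_proj (x : punctured n) :
    mfderiv 𝓘(ℝ, Space n) 𝓘(ℝ, Space n) (proj n a b) x =
      mfderiv 𝓘(ℝ, Space n) 𝓘(ℝ, Space n) (projExt a b) (x : Space n) := by
  have h : proj n a b = projExt a b ∘ Subtype.val := funext fun x => (projExt_coe x).symm
  obtain ⟨k, -, hk⟩ := exists_hasMFDerivAt_projExt (a := a) (b := b) x.2
  have := (hk.comp x (hasMFDerivAt_subtype_val x)).mfderiv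
  rw [← h] at this
  rw [this, hk.mfderiv]
  rfl

end Quotient

/-! ### The metric on the quotient -/

section Metric

variable {n : ℕ} {a b : ℝ} [NeZero n] [ha : Fact (0 < a)] [hb : Fact (0 < b)]
  (σ : Matrix (Fin n) (Fin n) ℝ)

/-- The form `e^{2u} g`, which is invariant under `φ_{a,b}`. -/
def invForm (a b : ℝ) (y : Space n) : Space n →L[ℝ] Space n →L[ℝ] ℝ :=
  Real.exp (2 * logFactor a b y) • metricForm σ y

omit [NeZero n] ha hb in
theorem invForm_apply (y v w : Space n) :
    invForm σ a b y v w = Real.exp (2 * logFactor a b y) * metricForm σ y v w := rfl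

omit [NeZero n] in
theorem invForm_flow (t : ℝ) {y : Space n} (hy : y ≠ 0) (v w : Space n) :
    invForm σ a b (flow a b t y) (flow a b t v) (flow a b t w) = invForm σ a b y v w := by
  rw [invForm_apply, invForm_apply, logFactor_flow t hy, flow, flow, flow, metricForm_scaling,
    ← mul_assoc, ← Real.exp_add]
  congr 2
  ring

omit [NeZero n] ha hb in
theorem contDiffAt_real_smul {E F : Type*} [NormedAddCommGroup E] [NormedSpace ℝ E]
    [NormedAddCommGroup F] [NormedSpace ℝ F] {f : E → ℝ} {g : E → F} {x : E}
    (hf : ContDiffAt ℝ ∞ f x) (hg : ContDiffAt ℝ ∞ g x) :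
    ContDiffAt ℝ ∞ (fun z => f z • g z) x := hf.smul hg

omit [NeZero n] in
theorem contDiffAt_invForm {y : Space n} (hy : y ≠ 0) : ContDiffAt ℝ ∞ (invForm σ a b) y := by
  have h1 : ContDiffAt ℝ ∞ (fun z : Space n => Real.exp (2 * logFactor a b z)) y :=
    (contDiffAt_const.mul (contDiffAt_logFactor hy)).exp
  exact contDiffAt_real_smul h1 (contDiff_metricForm σ).contDiffAt

/-- The metric on the quotient induced by `e^{2u} g`. -/
def quotientMetric (a b : ℝ) [Fact (0 < a)] [Fact (0 < b)] :
    TwoTensor (Fin 4 × Fin n) (QuotientSpace n a b) :=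
  fun q => invForm σ a b (chartAt (Space n) q q)

/-- The preferred chart reads the projection as a power of φ_{a,b}, under which `invForm` is
invariant; hence the choice of charts in `quotientMetric` is immaterial. -/
theorem quotientMetric_mfderiv_projExt {y : Space n} (hy : y ≠ 0) (v w : Space n) :
    quotientMetric σ a b (projExt a b y)
      (mfderiv 𝓘(ℝ, Space n) 𝓘(ℝ, Space n) (projExt a b) y v)
      (mfderiv 𝓘(ℝ, Space n) 𝓘(ℝ, Space n) (projExt a b) y w) = invForm σ a b y v w := by
  obtain ⟨k, hk, hd⟩ := exists_hasMFDerivAt_projExt (a := a) (b := b) hy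
  rw [hd.mfderiv, quotientMetric, hk]
  exact invForm_flow σ k hy v w

theorem pullback_proj_quotientMetric :
    pullback (proj n a b) (quotientMetric σ a b) =
      rescale (fun x : punctured n => logFactor a b (x : Space n)) (metric σ) := by
  funext x
  refine ContinuousLinearMap.ext fun v => ContinuousLinearMap.ext fun w => ?_
  refine Eq.trans ?_ (quotientMetric_mfderiv_projExt σ (a := a) (b := b) x.2 v w)
  rw [← mfderiv_proj, projExt_coe]
  rfl

theorem inConformalClass_pullback_proj :
    InConformalClass (metric σ) (pullback (proj n a b) (quotientMetric σ a b)) := by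
  refine ⟨_, fun x => ?_, pullback_proj_quotientMetric σ⟩
  exact contMDiffAt_subtype_iff.2 (contDiffAt_logFactor x.2).contMDiffAt

theorem isSemiRiemannianMetric_quotientMetric :
    IsSemiRiemannianMetric (2 * n) (2 * n) (quotientMetric σ a b) where
  smooth := by
    intro q₀
    rw [contMDiffAt_hom_bundle]
    refine ⟨contMDiffAt_id, ?_⟩
    have hsrc := (chartAt (Space n) q₀).open_source.mem_nhds (mem_chart_source (Space n) q₀)
    have hne (q : QuotientSpace n a b) (hq : q ∈ (chartAt (Space n) q₀).source) :
        chartAt (Space n) q₀ q ≠ 0 := (slabChart_mem hq).1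
    have h1 : ContMDiffAt 𝓘(ℝ, Space n) 𝓘(ℝ, Space n →L[ℝ] Space n →L[ℝ] ℝ) ∞
        (fun q => invForm σ a b (chartAt (Space n) q₀ q)) q₀ :=
      (contDiffAt_invForm σ (hne q₀ (mem_chart_source _ _))).contMDiffAt.comp q₀
        ((contMDiffOn_slabChart _).contMDiffAt hsrc)
    refine h1.congr_of_eventuallyEq ?_
    filter_upwards [hsrc] with q hq
    refine ContinuousLinearMap.ext fun v => ContinuousLinearMap.ext fun w => ?_
    -- The trivialisation at q₀ is inverted by the derivative of the inverse chart, which is the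
    -- projection itself. In it the metric becomes `invForm` composed with the chart.
    have hsymm (v : Space n) :
        (trivializationAt (Space n) (TangentSpace 𝓘(ℝ, Space n)) q₀).symm q v =
        mfderiv 𝓘(ℝ, Space n) 𝓘(ℝ, Space n) (projExt a b) (chartAt (Space n) q₀ q) v := by
      have := TangentBundle.symmL_trivializationAt (I := 𝓘(ℝ, Space n)) hq
      rw [← Bundle.Trivialization.symmL_apply (R := ℝ) _ hq, this, modelWithCornersSelf_coe,
        Set.range_id, mfderivWithin_univ]
      rfl
    rw [inCoordinates_apply_eq₂ (by exact hq) (by exact hq) (Set.mem_univ _)]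
    have h2 := quotientMetric_mfderiv_projExt σ (a := a) (b := b) (hne q hq) v w
    rw [← h2, hsymm, hsymm]
    have h3 : projExt a b (chartAt (Space n) q₀ q) = q := projExt_slabChart hq
    rw [h3]
    simp only [Bundle.Trivial.fiberBundle_trivializationAt',
      Bundle.Trivial.linearMapAt_trivialization, LinearMap.id_coe, id_eq]
  symm q v w := by
    exact congrArg (Real.exp _ * ·) (metricForm_comm σ _ v w)
  signature q := exists_orthonormal_basis σ _ _

/-! ### The metric in the charts of the quotient -/

theorem coordMatrix_rescale_quotientMetric (f : QuotientSpace n a b → ℝ) {τ : ℝ} {y : Space n}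
    (hy : y ∈ slab n a b τ) :
    coordMatrix (rescale f (quotientMetric σ a b)) (slabChart n a b τ) y =
      Real.exp (2 * (f (projExt a b y) + logFactor a b y)) • gram σ y := by
  ext i j
  have h := quotientMetric_mfderiv_projExt σ (a := a) (b := b) (ne_zero_of_mem_slab hy)
    (EuclideanSpace.single i 1) (EuclideanSpace.single j 1)
  have h1 : coordMatrix (rescale f (quotientMetric σ a b)) (slabChart n a b τ) y i j =
      Real.exp (2 * f (projExt a b y)) * invForm σ a b y
        (EuclideanSpace.single i 1) (EuclideanSpace.single j 1) := by
    rw [← h]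
    rfl
  rw [h1, invForm_apply, ← mul_assoc, ← Real.exp_add, ← mul_add]
  rfl

/-- The factor -u, taken in one slab chart, restores g there. Any other chart differs locally by the
m-th power of φ_{a,b}, leaving the constant exponent m(a+b). -/
theorem isLocallyConformallyRicciFlat_quotientMetric :
    IsLocallyConformallyRicciFlat (quotientMetric σ a b) := by
  intro q₀
  obtain ⟨y₀, hy₀, rfl⟩ := exists_projExt_eq q₀
  set τ := time a b y₀
  refine ⟨(slabChart n a b τ).source, (slabChart n a b τ).open_source,
    projExt_mem_source (mem_slab_time hy₀),
    fun q => -logFactor a b (slabChart n a b τ q), ?_, ?_⟩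
  · intro q hq
    exact ((contDiffAt_logFactor (slabChart_mem hq).1).neg.contMDiffAt.comp_contMDiffWithinAt q
      (contMDiffOn_slabChart τ q hq))
  · rintro _ ⟨τ', rfl⟩ q ⟨hq', hq⟩ j k
    set y := slabChart n a b τ' q with hy
    have hym : y ∈ slab n a b τ' := slabChart_mem hq'
    obtain ⟨m, hm⟩ := slabChart_projExt_eventuallyEq (τ := τ) (ne_zero_of_mem_slab hym)
      (by rw [hy, projExt_slabChart hq']; exact hq)
    rw [← ricciComponent_exp_smul_gram σ (m * (a + b)) j k y]
    refine ricciComponent_congr ?_ j k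
    filter_upwards [hm, (isOpen_slab τ').mem_nhds hym] with z hz hzs
    rw [coordMatrix_rescale_quotientMetric σ _ hzs, hz.2, logFactor_flow _ hz.1]
    congr 3
    ring

theorem not_isConformallyFlat_quotientMetric (hσ : σ ≠ 0) :
    ¬ IsConformallyFlat (quotientMetric σ a b) := by
  intro hflat
  obtain ⟨p, q, hpq⟩ : ∃ p q, σ p q ≠ 0 := by
    by_contra! h
    exact hσ (Matrix.ext h)
  set y : Space n := (basePoint n).1 with hy
  have hy0 : y ≠ 0 := (basePoint n).2
  obtain ⟨U, hU, hyU, f, hf, hUf⟩ := hflat (projExt a b y)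
  have hym := mem_slab_time (a := a) (b := b) hy0
  have h := hUf _ (slabChart_mem_atlas (time a b y)) _ ⟨projExt_mem_source hym, hyU⟩
    (2, p) (1, q) (1, q) (0, p)
  rw [slabChart_projExt hym, curvatureComponent_congr
    (G' := fun z => Real.exp (2 * (f (projExt a b z) + logFactor a b z)) • gram σ z)
    (Filter.eventuallyEq_of_mem ((isOpen_slab _).mem_nhds hym)
      fun z hz => coordMatrix_rescale_quotientMetric σ f hz),
    curvatureComponent_exp_smul_gram] at h
  · exact hpq (pow_eq_zero_iff two_ne_zero |>.1 h)
  · have h1 : ContMDiffAt 𝓘(ℝ, Space n) 𝓘(ℝ, ℝ) ∞ (fun z => f (projExt a b z)) y :=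
      (hf.contMDiffAt (hU.mem_nhds hyU)).comp y (contMDiffAt_projExt hy0)
    exact h1.contDiffAt.add (contDiffAt_logFactor hy0)
  -- The only nonzero coordinate of the base point lies in block 2, which q does not involve, so dq
  -- = 0 there.
  · intro r
    rw [grad_apply]
    refine Finset.sum_eq_zero fun s _ => ?_
    by_cases hs : s = (2, 0)
    · rw [hess_comm, hs, hess_eq_zero σ (le_refl (2 : Fin 4)), zero_mul]
    · simp [hy, basePoint, hs]

end Metric

/-! ### Conformal transformations of the quotient -/

section Transformations

variable {n : ℕ} {a b : ℝ} [NeZero n] [ha : Fact (0 < a)] [hb : Fact (0 < b)]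

variable (n a b) in
/-- The map of the quotient induced by `φ_{c,d}`. -/
def quotientScaling (c d : ℝ) (q : QuotientSpace n a b) : QuotientSpace n a b :=
  projExt a b (scaling n c d (q.out : Space n))

omit [NeZero n] ha hb in
theorem exists_flow_eq_out (x : punctured n) :
    ∃ k : ℤ, flow a b k (x : Space n) = ((proj n a b x).out : Space n) :=
  proj_eq_proj_iff.1 (Quotient.out_eq (proj n a b x))

omit ha hb in
theorem exists_flow_eq_out_projExt {y : Space n} (hy : y ≠ 0) :
    ∃ k : ℤ, flow a b k y = ((projExt a b y).out : Space n) := by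
  have := exists_flow_eq_out (a := a) (b := b) (toPunctured y)
  rwa [coe_toPunctured hy] at this

omit ha hb in
-- Diagonal maps commute, so the chosen representative does not matter.
theorem quotientScaling_projExt (c d : ℝ) {y : Space n} (hy : y ≠ 0) :
    quotientScaling n a b c d (projExt a b y) = projExt a b (scaling n c d y) := by
  obtain ⟨k, hk⟩ := exists_flow_eq_out_projExt (a := a) (b := b) hy
  rw [quotientScaling, ← hk, ← flow_scaling, projExt_flow k (scaling_ne_zero _ _ hy)]

omit ha hb in
theorem quotientScaling_neg (c d : ℝ) (q : QuotientSpace n a b) :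
    quotientScaling n a b (-c) (-d) (quotientScaling n a b c d q) = q := by
  obtain ⟨y, hy, rfl⟩ := exists_projExt_eq q
  rw [quotientScaling_projExt _ _ hy, quotientScaling_projExt _ _ (scaling_ne_zero _ _ hy),
    scaling_scaling, neg_add_cancel, neg_add_cancel, scaling_zero]

theorem contMDiff_quotientScaling (c d : ℝ) :
    ContMDiff 𝓘(ℝ, Space n) 𝓘(ℝ, Space n) ∞ (quotientScaling n a b c d) := by
  refine contMDiff_of_comp_projExt fun y hy => ?_
  have h1 : ContMDiffAt 𝓘(ℝ, Space n) 𝓘(ℝ, Space n) ∞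
      (fun y => projExt a b (scaling n c d y)) y :=
    (contMDiffAt_projExt (scaling_ne_zero c d hy)).comp y (contDiff_scaling c d).contMDiff.contMDiffAt
  exact h1.congr_of_eventuallyEq
    (Filter.eventuallyEq_of_mem (isOpen_ne.mem_nhds hy) fun z hz => quotientScaling_projExt c d hz)

variable (n a b) in
/-- The diffeomorphism of the quotient induced by `φ_{c,d}`. -/
def scalingDiffeo (c d : ℝ) :
    QuotientSpace n a b ≃ₘ^∞⟮𝓘(ℝ, Space n), 𝓘(ℝ, Space n)⟯ QuotientSpace n a b where
  toFun := quotientScaling n a b c d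
  invFun := quotientScaling n a b (-c) (-d)
  left_inv := quotientScaling_neg c d
  right_inv q := by simpa using quotientScaling_neg (-c) (-d) q
  contMDiff_toFun := contMDiff_quotientScaling c d
  contMDiff_invFun := contMDiff_quotientScaling (-c) (-d)

theorem mfderiv_quotientScaling (c d : ℝ) {y : Space n} (hy : y ≠ 0) (v : Space n) :
    mfderiv 𝓘(ℝ, Space n) 𝓘(ℝ, Space n) (quotientScaling n a b c d) (projExt a b y)
      (mfderiv 𝓘(ℝ, Space n) 𝓘(ℝ, Space n) (projExt a b) y v) =
    mfderiv 𝓘(ℝ, Space n) 𝓘(ℝ, Space n) (projExt a b) (scaling n c d y) (scaling n c d v) := by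
  have h1 := ((contMDiff_quotientScaling (a := a) (b := b) c d
    (projExt a b y)).mdifferentiableAt (by simp)).hasMFDerivAt
  have h2 := ((contMDiffAt_projExt (a := a) (b := b) hy).mdifferentiableAt
    (by simp)).hasMFDerivAt
  have h3 := ((contMDiffAt_projExt (a := a) (b := b) (scaling_ne_zero c d hy)).mdifferentiableAt
    (by simp)).hasMFDerivAt
  have h4 : HasMFDerivAt 𝓘(ℝ, Space n) 𝓘(ℝ, Space n) (scaling n c d) y
      ((scaling n c d).toContinuousLinearEquiv : Space n →L[ℝ] Space n) :=
    (scaling n c d).toContinuousLinearEquiv.hasFDerivAt.hasMFDerivAt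
  have h5 : quotientScaling n a b c d ∘ projExt a b =ᶠ[𝓝 y] projExt a b ∘ scaling n c d :=
    Filter.eventuallyEq_of_mem (isOpen_ne.mem_nhds hy) fun z hz => quotientScaling_projExt c d hz
  have h6 := hasMFDerivAt_unique (h1.comp y h2) ((h3.comp y h4).congr_of_eventuallyEq h5)
  exact congrArg (fun L : Space n →L[ℝ] Space n => L v) h6

variable (σ : Matrix (Fin n) (Fin n) ℝ)

/-- Keeping f arbitrary serves two ends: f = 0 gives conformality, and a general f is used to
exclude invariant metrics. -/
theorem pullback_scalingDiffeo (c d : ℝ) (f : QuotientSpace n a b → ℝ) {y : Space n}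
    (hy : y ≠ 0) (v w : Space n) :
    pullback (scalingDiffeo n a b c d) (rescale f (quotientMetric σ a b)) (projExt a b y)
      (mfderiv 𝓘(ℝ, Space n) 𝓘(ℝ, Space n) (projExt a b) y v)
      (mfderiv 𝓘(ℝ, Space n) 𝓘(ℝ, Space n) (projExt a b) y w) =
    Real.exp (2 * (f (projExt a b (scaling n c d y)) + logFactor a b (scaling n c d y) + (c + d)))
      * metricForm σ y v w := by
  have h := quotientMetric_mfderiv_projExt σ (a := a) (b := b) (scaling_ne_zero c d hy)
    (scaling n c d v) (scaling n c d w)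
  have h1 : pullback (scalingDiffeo n a b c d) (rescale f (quotientMetric σ a b)) (projExt a b y)
      (mfderiv 𝓘(ℝ, Space n) 𝓘(ℝ, Space n) (projExt a b) y v)
      (mfderiv 𝓘(ℝ, Space n) 𝓘(ℝ, Space n) (projExt a b) y w) =
      Real.exp (2 * f (projExt a b (scaling n c d y))) *
        invForm σ a b (scaling n c d y) (scaling n c d v) (scaling n c d w) := by
    rw [← h, ← mfderiv_quotientScaling c d hy, ← mfderiv_quotientScaling c d hy,
      ← quotientScaling_projExt c d hy]
    rfl
  rw [h1, invForm_apply, metricForm_scaling, ← mul_assoc, ← mul_assoc, ← Real.exp_add,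
    ← Real.exp_add]
  congr 2
  ring

theorem surjective_mfderiv_projExt {y : Space n} (hy : y ≠ 0) :
    Function.Surjective (mfderiv 𝓘(ℝ, Space n) 𝓘(ℝ, Space n) (projExt a b) y) := by
  obtain ⟨k, -, hk⟩ := exists_hasMFDerivAt_projExt (a := a) (b := b) hy
  rw [hk.mfderiv]
  exact (flowEquiv n a b k).surjective

theorem rescale_quotientMetric_mfderiv_projExt (f : QuotientSpace n a b → ℝ) {y : Space n}
    (hy : y ≠ 0) (v w : Space n) :
    rescale f (quotientMetric σ a b) (projExt a b y)
      (mfderiv 𝓘(ℝ, Space n) 𝓘(ℝ, Space n) (projExt a b) y v)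
      (mfderiv 𝓘(ℝ, Space n) 𝓘(ℝ, Space n) (projExt a b) y w) =
    Real.exp (2 * (f (projExt a b y) + logFactor a b y)) * metricForm σ y v w := by
  have h := quotientMetric_mfderiv_projExt σ (a := a) (b := b) hy v w
  rw [mul_add, Real.exp_add, mul_assoc, ← invForm_apply, ← h]
  rfl

/-- The logarithmic conformal factor of `scalingDiffeo`. -/
def scalingFactor (c d : ℝ) (q : QuotientSpace n a b) : ℝ :=
  logFactor a b (scaling n c d (q.out : Space n)) + (c + d) - logFactor a b (q.out : Space n)

theorem scalingFactor_projExt (c d : ℝ) {y : Space n} (hy : y ≠ 0) :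
    scalingFactor c d (projExt a b y) =
      logFactor a b (scaling n c d y) + (c + d) - logFactor a b y := by
  obtain ⟨k, hk⟩ := exists_flow_eq_out_projExt (a := a) (b := b) hy
  rw [scalingFactor, ← hk, ← flow_scaling, logFactor_flow _ hy,
    logFactor_flow _ (scaling_ne_zero c d hy)]
  ring

theorem isConformalTransformation_scalingDiffeo (c d : ℝ) :
    IsConformalTransformation (quotientMetric σ a b) (scalingDiffeo n a b c d) := by
  refine ⟨scalingFactor c d, contMDiff_of_comp_projExt fun y hy => ?_, ?_⟩
  · have h1 : ContDiffAt ℝ ∞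
        (fun y => logFactor a b (scaling n c d y) + (c + d) - logFactor a b y) y :=
      (((contDiffAt_logFactor (scaling_ne_zero c d hy)).comp y
        (contDiff_scaling c d).contDiffAt).add contDiffAt_const).sub (contDiffAt_logFactor hy)
    exact h1.contMDiffAt.congr_of_eventuallyEq
      (Filter.eventuallyEq_of_mem (isOpen_ne.mem_nhds hy) fun z hz => scalingFactor_projExt c d hz)
  · funext q
    obtain ⟨y, hy, rfl⟩ := exists_projExt_eq q
    refine ContinuousLinearMap.ext fun v => ContinuousLinearMap.ext fun w => ?_
    obtain ⟨v, rfl⟩ := surjective_mfderiv_projExt hy v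
    obtain ⟨w, rfl⟩ := surjective_mfderiv_projExt hy w
    have h0 : quotientMetric σ a b = rescale (fun _ => 0) (quotientMetric σ a b) := by
      funext q
      simp [rescale]
    have h1 := pullback_scalingDiffeo σ c d (fun _ => 0) (a := a) (b := b) hy v w
    have h2 := rescale_quotientMetric_mfderiv_projExt σ (a := a) (b := b) (scalingFactor c d) hy v w
    rw [← h0] at h1
    rw [scalingFactor_projExt c d hy] at h2
    refine h1.trans (Eq.trans ?_ h2.symm)
    congr 2
    ring

/-- `φ_{0,1}` induces an essential conformal transformation: it fixes points at which it is
infinitesimally a homothety with factor different from `1`. -/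
theorem isEssential_scalingDiffeo :
    IsEssential (quotientMetric σ a b) (scalingDiffeo n a b 0 1) := by
  refine ⟨isConformalTransformation_scalingDiffeo σ 0 1, ?_⟩
  rintro ⟨_, ⟨f, -, rfl⟩, hf⟩
  -- For (c, d) = (0, 1) the first block has weight 0, so its vectors are fixed.
  set y : Space n := EuclideanSpace.single (0, 0) 1
  have hy : y ≠ 0 := fun h => one_ne_zero ((PiLp.single_eq_zero_iff 2 _).1 h)
  have hfix : scaling n 0 1 y = y := by
    ext p
    rw [scaling_apply]
    by_cases hp : p = (0, 0)
    · simp [hp, weight]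
    · simp [y, hp]
  have h1 := pullback_scalingDiffeo σ 0 1 f (a := a) (b := b) hy (EuclideanSpace.single (0, 0) 1)
    (EuclideanSpace.single (2, 0) 1)
  rw [hf, rescale_quotientMetric_mfderiv_projExt σ f hy, hfix] at h1
  have h2 : metricForm σ y (EuclideanSpace.single (0, 0) 1) (EuclideanSpace.single (2, 0) 1) = 1 := by
    have := gram_apply σ y (0, 0) (2, 0)
    rw [grad_eq_zero σ (le_refl (2 : Fin 4)) (p := (2, 0))] at this
    simpa [gram, dual] using this
  -- Invariance at the fixed point would equate the exponents f + u and f + u + 1.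
  rw [h2, mul_one, mul_one, Real.exp_eq_exp] at h1
  linarith

end Transformations

/-! ### The diffeomorphism with `S¹ × S^{4n-1}` -/

section Product

variable {n : ℕ} {a b : ℝ} [NeZero n] [ha : Fact (0 < a)] [hb : Fact (0 < b)]

/-- The unit sphere of `ℝ^{4n}`. -/
abbrev UnitSphere (n : ℕ) : Type :=
  Metric.sphere (0 : EuclideanSpace ℝ (Fin (4 * n - 1 + 1))) 1

/-- The ambient dimension is written as a successor to suit the manifold structure on spheres; it
equals 4n once n ≥ 1. -/
theorem contMDiff_coe_unitSphere (n : ℕ) :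
    ContMDiff (𝓡 (4 * n - 1)) 𝓘(ℝ, EuclideanSpace ℝ (Fin (4 * n - 1 + 1))) ∞
      ((↑) : UnitSphere n → EuclideanSpace ℝ (Fin (4 * n - 1 + 1))) := by
  have : Fact (Module.finrank ℝ (EuclideanSpace ℝ (Fin (4 * n - 1 + 1))) = 4 * n - 1 + 1) :=
    ⟨finrank_euclideanSpace_fin⟩
  exact contMDiff_coe_sphere

theorem contMDiff_coe_circle : ContMDiff (𝓡 1) 𝓘(ℝ, ℂ) ∞ (fun z : Circle => (z : ℂ)) := by
  have : Fact (Module.finrank ℝ ℂ = 1 + 1) := finrank_real_complex_fact'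
  exact contMDiff_coe_sphere

/-- The standard identification of `ℝ^{4n}`, arranged in blocks, with `ℝ^{4n}`. -/
def flatten (n : ℕ) [NeZero n] : Space n ≃ₗᵢ[ℝ] EuclideanSpace ℝ (Fin (4 * n - 1 + 1)) :=
  LinearIsometryEquiv.piLpCongrLeft 2 ℝ ℝ (finProdFinEquiv.trans
    (finCongr (by have := NeZero.pos n; omega)))

/-- The projection of `ℝ^{4n} ∖ {0}` to the unit sphere along the flow. -/
def radial (a b : ℝ) (y : Space n) : Space n := flow a b (-time a b y) y

omit [NeZero n] in
theorem radial_flow (t : ℝ) {y : Space n} (hy : y ≠ 0) :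
    radial a b (flow a b t y) = radial a b y := by
  rw [radial, radial, time_flow t hy, flow_flow]
  congr 1
  ring

omit [NeZero n] in
theorem contDiffAt_radial {y : Space n} (hy : y ≠ 0) :
    ContDiffAt ℝ ∞ (radial a b : Space n → Space n) y :=
  (contDiff_flow_uncurry a b).contDiffAt.comp y (contDiffAt_id.prodMk (contDiffAt_time hy).neg)

variable (n a b) in
/-- The position on the sphere of a point of the quotient. -/
def spherePart (q : QuotientSpace n a b) : EuclideanSpace ℝ (Fin (4 * n - 1 + 1)) :=
  flatten n (radial a b (q.out : Space n))

theorem spherePart_mem (q : QuotientSpace n a b) :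
    spherePart n a b q ∈ Metric.sphere (0 : EuclideanSpace ℝ (Fin (4 * n - 1 + 1))) 1 := by
  rw [mem_sphere_zero_iff_norm, spherePart, LinearIsometryEquiv.norm_map]
  exact norm_flow_neg_time q.out.2

theorem spherePart_projExt {y : Space n} (hy : y ≠ 0) :
    spherePart n a b (projExt a b y) = flatten n (radial a b y) := by
  obtain ⟨k, hk⟩ := exists_flow_eq_out_projExt (a := a) (b := b) hy
  rw [spherePart, ← hk, radial_flow _ hy]

theorem contMDiff_spherePart : ContMDiff 𝓘(ℝ, Space n)
    𝓘(ℝ, EuclideanSpace ℝ (Fin (4 * n - 1 + 1))) ∞ (spherePart n a b) := by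
  refine contMDiff_of_comp_projExt fun y hy => ?_
  have h1 : ContDiffAt ℝ ∞ (fun y => flatten n (radial a b y)) y :=
    (flatten n).contDiff.contDiffAt.comp y (contDiffAt_radial hy)
  exact h1.contMDiffAt.congr_of_eventuallyEq
    (Filter.eventuallyEq_of_mem (isOpen_ne.mem_nhds hy) fun z hz => spherePart_projExt hz)

variable (n a b) in
/-- The position on the circle of a point of the quotient. -/
def circlePart (q : QuotientSpace n a b) : Circle :=
  Circle.exp (2 * Real.pi * time a b (q.out : Space n))

theorem circlePart_projExt {y : Space n} (hy : y ≠ 0) :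
    circlePart n a b (projExt a b y) = Circle.exp (2 * Real.pi * time a b y) := by
  obtain ⟨k, hk⟩ := exists_flow_eq_out_projExt (a := a) (b := b) hy
  rw [circlePart, ← hk, time_flow _ hy, Circle.exp_eq_exp]
  exact ⟨k, by ring⟩

theorem contMDiff_circlePart : ContMDiff 𝓘(ℝ, Space n) (𝓡 1) ∞ (circlePart n a b) := by
  refine contMDiff_of_comp_projExt fun y hy => ?_
  have h1 : ContDiffAt ℝ ∞ (fun y => 2 * Real.pi * time a b y) y :=
    contDiffAt_const.mul (contDiffAt_time hy)
  have h2 : ContMDiffAt 𝓘(ℝ, Space n) (𝓡 1) ∞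
      (fun y => Circle.exp (2 * Real.pi * time a b y)) y :=
    contMDiff_circleExp.contMDiffAt.comp y h1.contMDiffAt
  exact h2.congr_of_eventuallyEq
    (Filter.eventuallyEq_of_mem (isOpen_ne.mem_nhds hy) fun z hz => circlePart_projExt hz)

variable (n a b) in
/-- The point of the quotient with the given positions on the circle and the sphere. -/
def ofProd (p : Circle × UnitSphere n) : QuotientSpace n a b :=
  projExt a b (flow a b ((p.1 : ℂ).arg / (2 * Real.pi)) ((flatten n).symm p.2))

omit ha hb in
theorem norm_flatten_symm (s : UnitSphere n) : ‖(flatten n).symm s‖ = 1 := by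
  rw [LinearIsometryEquiv.norm_map]
  exact mem_sphere_zero_iff_norm.1 s.2

omit ha hb in
theorem flatten_symm_ne_zero (s : UnitSphere n) : (flatten n).symm (s : EuclideanSpace ℝ _) ≠ 0 :=
  norm_pos_iff.1 (by rw [norm_flatten_symm]; exact one_pos)

omit ha hb in
-- Two determinations of the angle differ by an integer number of turns, hence by a power of
-- φ_{a,b}. This permits replacing the discontinuous `arg` by a local smooth branch.
theorem ofProd_eq {θ : ℝ} {p : Circle × UnitSphere n} (hθ : Circle.exp (2 * Real.pi * θ) = p.1) :
    ofProd n a b p = projExt a b (flow a b θ ((flatten n).symm p.2)) := by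
  rw [← Circle.exp_arg p.1, Circle.exp_eq_exp] at hθ
  obtain ⟨m, hm⟩ := hθ
  have h : θ = m + (p.1 : ℂ).arg / (2 * Real.pi) := by
    field_simp
    linarith
  rw [h, ← flow_flow, projExt_flow m (flow_ne_zero _ _ _ (flatten_symm_ne_zero p.2)), ofProd]

theorem contMDiff_ofProd :
    ContMDiff ((𝓡 1).prod (𝓡 (4 * n - 1))) 𝓘(ℝ, Space n) ∞ (ofProd n a b) := by
  intro p₀
  -- A branch of the angle that is smooth at p₀: rotate p₀ to 1, where the logarithm is smooth, then
  -- add back the argument of p₀.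
  set θ : Circle × UnitSphere n → ℝ := fun p =>
    (((p.1 * p₀.1⁻¹ : Circle) : ℂ).arg + (p₀.1 : ℂ).arg) / (2 * Real.pi) with hθ
  have hexp (p : Circle × UnitSphere n) : Circle.exp (2 * Real.pi * θ p) = p.1 := by
    have : 2 * Real.pi * θ p = ((p.1 * p₀.1⁻¹ : Circle) : ℂ).arg + (p₀.1 : ℂ).arg := by
      rw [hθ]
      field_simp
    rw [this, Circle.exp_add, Circle.exp_arg, Circle.exp_arg, inv_mul_cancel_right]
  have h1 : ofProd n a b = projExt a b ∘
      (fun p => flow a b (θ p) ((flatten n).symm (p.2 : EuclideanSpace ℝ _))) :=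
    funext fun p => ofProd_eq (hexp p)
  have hlog : ContDiffAt ℝ ∞ (fun z : ℂ => (Complex.log z).im) ((p₀.1 * p₀.1⁻¹ : Circle) : ℂ) := by
    have : ContDiffAt ℂ ∞ Complex.log ((p₀.1 * p₀.1⁻¹ : Circle) : ℂ) :=
      Complex.contDiffAt_log (by simp)
    exact Complex.imCLM.contDiff.contDiffAt.comp _ (this.restrict_scalars ℝ)
  have hmul : ContMDiff ((𝓡 1).prod (𝓡 (4 * n - 1))) 𝓘(ℝ, ℂ) ∞
      (fun p : Circle × UnitSphere n => ((p.1 * p₀.1⁻¹ : Circle) : ℂ)) := by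
    exact contMDiff_coe_circle.comp ((contMDiff_mul_right (I := 𝓡 1) (n := ∞) (a := p₀.1⁻¹)).comp contMDiff_fst)
  have hθs : ContMDiffAt ((𝓡 1).prod (𝓡 (4 * n - 1))) 𝓘(ℝ, ℝ) ∞ θ p₀ := by
    have h2 : ContMDiffAt ((𝓡 1).prod (𝓡 (4 * n - 1))) 𝓘(ℝ, ℝ) ∞
        (fun p : Circle × UnitSphere n => ((p.1 * p₀.1⁻¹ : Circle) : ℂ).arg) p₀ := by
      simpa only [Function.comp_def, Complex.log_im] using hlog.contMDiffAt.comp p₀ (hmul p₀)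
    have h3 : ContDiff ℝ ∞ (fun t : ℝ => (t + (p₀.1 : ℂ).arg) / (2 * Real.pi)) := by fun_prop
    exact h3.contMDiff.contMDiffAt.comp p₀ h2
  have hsph : ContMDiff ((𝓡 1).prod (𝓡 (4 * n - 1))) 𝓘(ℝ, Space n) ∞
      (fun p : Circle × UnitSphere n => (flatten n).symm (p.2 : EuclideanSpace ℝ _)) :=
    (flatten n).symm.contDiff.contMDiff.comp ((contMDiff_coe_unitSphere n).comp contMDiff_snd)
  rw [h1]
  refine (contMDiffAt_projExt (flow_ne_zero _ _ _ (flatten_symm_ne_zero p₀.2))).comp p₀ ?_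
  exact (contDiff_flow_uncurry a b).contMDiff.contMDiffAt.comp p₀ ((hsph p₀).prodMk_space hθs)

theorem ofProd_parts (q : QuotientSpace n a b) :
    ofProd n a b (circlePart n a b q, ⟨spherePart n a b q, spherePart_mem q⟩) = q := by
  obtain ⟨y, hy, rfl⟩ := exists_projExt_eq q
  rw [ofProd_eq (circlePart_projExt hy).symm]
  change projExt a b (flow a b _ ((flatten n).symm (spherePart n a b _))) = _
  rw [spherePart_projExt hy, LinearIsometryEquiv.symm_apply_apply, radial, flow_flow,
    add_neg_cancel, flow_zero]

theorem parts_ofProd (p : Circle × UnitSphere n) :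
    circlePart n a b (ofProd n a b p) = p.1 ∧ spherePart n a b (ofProd n a b p) = p.2 := by
  have h0 := flatten_symm_ne_zero p.2
  have ht := time_eq_zero (a := a) (b := b) (norm_flatten_symm p.2)
  have h1 := flow_ne_zero a b ((p.1 : ℂ).arg / (2 * Real.pi)) h0
  constructor
  · rw [ofProd, circlePart_projExt h1, time_flow _ h0, ht, zero_add,
      mul_div_cancel₀ _ (by positivity), Circle.exp_arg]
  · rw [ofProd, spherePart_projExt h1, radial_flow _ h0, radial, ht, neg_zero, flow_zero,
      LinearIsometryEquiv.apply_symm_apply]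

variable (n a b) in
/-- The quotient is diffeomorphic to `S¹ × S^{4n-1}`. -/
def diffeoProd : QuotientSpace n a b ≃ₘ^∞⟮𝓘(ℝ, Space n), (𝓡 1).prod (𝓡 (4 * n - 1))⟯
    (Circle × UnitSphere n) where
  toFun q := (circlePart n a b q, ⟨spherePart n a b q, spherePart_mem q⟩)
  invFun := ofProd n a b
  left_inv := ofProd_parts
  right_inv p := Prod.ext (parts_ofProd p).1 (Subtype.ext (parts_ofProd p).2)
  contMDiff_toFun := by
    have : Fact (Module.finrank ℝ (EuclideanSpace ℝ (Fin (4 * n - 1 + 1))) = 4 * n - 1 + 1) :=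
      ⟨finrank_euclideanSpace_fin⟩
    exact contMDiff_circlePart.prodMk (contMDiff_spherePart.codRestrict_sphere spherePart_mem)
  contMDiff_invFun := contMDiff_ofProd

end Product

end ConformalQuotient

end

open ConformalQuotient in
theorem theorem3p4 (n : ℕ) (σ : Matrix (Fin n) (Fin n) ℝ) (hσ_symm : σ.IsSymm) (hσ : σ ≠ 0)
    (a b : ℝ) (ha : 0 < a) (hb : 0 < b) :
    -- the quotient is a compact smooth manifold, the smooth structure being the one that makes
    -- the projection a local diffeomorphism
    CompactSpace (QuotientSpace n a b) ∧ T2Space (QuotientSpace n a b) ∧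
    SecondCountableTopology (QuotientSpace n a b) ∧
    ∃ (_ : ChartedSpace (Space n) (QuotientSpace n a b))
      (_ : IsManifold 𝓘(ℝ, Space n) ∞ (QuotientSpace n a b)),
      IsLocalDiffeomorph 𝓘(ℝ, Space n) 𝓘(ℝ, Space n) ∞ (proj n a b) ∧
      -- it is diffeomorphic to the product of the circle and the unit sphere of `ℝ^{4n}`
      Nonempty (QuotientSpace n a b ≃ₘ^∞⟮𝓘(ℝ, Space n), (𝓡 1).prod (𝓡 (4 * n - 1))⟯
        (Circle × Metric.sphere (0 : EuclideanSpace ℝ (Fin (4 * n - 1 + 1))) 1)) ∧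
      -- the conformal class of `g` descends to the class of a metric `c` on the quotient
      ∃ c : TwoTensor (Fin 4 × Fin n) (QuotientSpace n a b),
        IsSemiRiemannianMetric (2 * n) (2 * n) c ∧
        InConformalClass (metric σ) (pullback (proj n a b) c) ∧
        IsLocallyConformallyRicciFlat c ∧
        ¬ IsConformallyFlat c ∧
        ∃ ψ : QuotientSpace n a b ≃ₘ^∞⟮𝓘(ℝ, Space n), 𝓘(ℝ, Space n)⟯ QuotientSpace n a b,
          IsEssential c ψ := by
  -- A nonzero matrix forces n ≥ 1.
  have : NeZero n := ⟨by rintro rfl; exact hσ (Subsingleton.elim _ _)⟩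
  have : Fact (0 < a) := ⟨ha⟩
  have : Fact (0 < b) := ⟨hb⟩
  -- The three topological properties are transported from the product of the circle and the sphere.
  have e := (diffeoProd n a b).toHomeomorph
  exact ⟨e.symm.compactSpace, e.symm.t2Space, e.secondCountableTopology, inferInstance,
    inferInstance, isLocalDiffeomorph_proj, ⟨diffeoProd n a b⟩, quotientMetric σ a b,
    isSemiRiemannianMetric_quotientMetric σ, inConformalClass_pullback_proj σ,
    isLocallyConformallyRicciFlat_quotientMetric σ, not_isConformallyFlat_quotientMetric σ hσ,
    scalingDiffeo n a b 0 1, isEssential_scalingDiffeo σ⟩
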